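/- Consider the Hunter–Saxton equation on $\mathbb{R}\times[0,\infty)$, $$\partial_t u(x,t)+\partial_x\Big[\tfrac12 u^2(x,t)\Big]=\tfrac12\int_{-\infty}^x w^2(y,t)\,dy,\qquad w(x,t)=\partial_x u(x,t),\qquad u(x,0)=u_0(x).$$ A continuous function $u:\mathbb{R}\times[0,\infty)\to\mathbb{R}$ is called a *weak solution* with initial datum $u_0$ if $u(\cdot,t)$ is absolutely continuous (on every bounded interval) for each $t\ge 0$, its derivative $w=\partial_xu$ belongs to $L^\infty([0,\infty);L^2(\mathbb{R}))$, the map $t\mapsto u(\cdot,t)\in L^2_{loc}(\mathbb{R})$ is (locally) absolutely continuous on $[0,\infty)$, the equation holds in the sense of distributions, $u(x,0)=u_0(x)$ for all $x$, and $w_0:=u_0'\in L^2(\mathbb{R})$. For $t\in(0,\infty)$ put $$I_t=\Big\{\zeta\in\mathbb{R}:\ u_0'(\zeta)\text{ exists and } w_0(\zeta)=u_0'(\zeta)>-\tfrac{2}{t}\Big\}.$$ **Proposition.** Let $u$ be a weak solution of the Hunter–Saxton equation with initial datum $u_0$. Then for every $t\in(0,\infty)$ the function $w(\cdot,t)$ is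 square integrable on $\mathbb{R}$ and $$\int_{\mathbb{R}}w^2(y,t)\,dy\ \ge\ \int_{I_t}w_0^2(\zeta)\,d\zeta .$$ -/

import Mathlib

open MeasureTheory Set
open scoped ContDiff ENNReal NNReal

noncomputable section

namespace HunterSaxton

/-- The spatial derivative `w(x, t) = ∂ₓ u(x, t)` of a function `u` of `(x, t)`. -/
def spatialDeriv (u : ℝ → ℝ → ℝ) (x t : ℝ) : ℝ :=
  deriv (fun y => u y t) x

/-- `u(·, t) ∈ L²_loc(ℝ)` depends absolutely continuously on `t ∈ [0, ∞)`: for every bounded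
interval `[-R, R]` and every `T > 0`, the map `t ↦ u(·, t)|_[-R, R] ∈ L²([-R, R])` is absolutely
continuous on `[0, T]`. -/
def IsAbsContInL2Loc (u : ℝ → ℝ → ℝ) : Prop :=
  ∀ R > (0 : ℝ), ∀ T > (0 : ℝ),
    ∃ F : ℝ → Lp ℝ 2 (volume.restrict (Icc (-R) R)),
      (∀ t ∈ Icc 0 T, ∀ᵐ x ∂(volume.restrict (Icc (-R) R)), F t x = u x t) ∧
      AbsolutelyContinuousOnInterval F 0 T

/-- The equation `∂ₜ u + ∂ₓ (u² / 2) = (1/2) ∫_{-∞}^x w²(y, t) dy` in the sense of distributions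
on the open upper half-plane; points are pairs `p = (x, t)`. -/
def SolvesDistributionally (u : ℝ → ℝ → ℝ) : Prop :=
  ∀ φ : ℝ × ℝ → ℝ, ContDiff ℝ ∞ φ → HasCompactSupport φ →
    tsupport φ ⊆ {p : ℝ × ℝ | 0 < p.2} →
    ∫ p in {p : ℝ × ℝ | 0 < p.2},
      (u p.1 p.2 * fderiv ℝ φ p (0, 1)
        + (1 / 2) * (u p.1 p.2) ^ 2 * fderiv ℝ φ p (1, 0)
        + (1 / 2) * (∫ y in Iic p.1, (spatialDeriv u y p.2) ^ 2) * φ p) = 0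

/-- `u` is a weak solution of the Hunter-Saxton equation on `ℝ × [0, ∞)` with initial datum `u₀`.
The values `u x t` with `t < 0` play no role. -/
structure IsWeakSolution (u : ℝ → ℝ → ℝ) (u₀ : ℝ → ℝ) : Prop where
  continuousOn : ContinuousOn (fun p : ℝ × ℝ => u p.1 p.2) {p : ℝ × ℝ | 0 ≤ p.2}
  absCont : ∀ t, 0 ≤ t → ∀ a b : ℝ, AbsolutelyContinuousOnInterval (fun x => u x t) a b
  /-- `w ∈ L^∞([0, ∞); L²(ℝ))`. -/
  deriv_bound : ∃ C : ℝ≥0, ∀ᵐ t ∂(volume.restrict (Ici (0 : ℝ))),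
    eLpNorm (fun x => spatialDeriv u x t) 2 volume ≤ C
  absContInTime : IsAbsContInL2Loc u
  equation : SolvesDistributionally u
  initial : ∀ x, u x 0 = u₀ x
  initial_deriv : MemLp (deriv u₀) 2 volume

/-- The set `I_t` of the points `ζ` at which `u₀'(ζ)` exists and `u₀'(ζ) > -2 / t` (used for
`t > 0`). -/
def survivalSet (u₀ : ℝ → ℝ) (t : ℝ) : Set ℝ :=
  {ζ | DifferentiableAt ℝ u₀ ζ ∧ -2 / t < deriv u₀ ζ}

end HunterSaxton

end

/-! Formally `w` satisfies `∂ₜw + u ∂ₓw = -w²/2`. Along a characteristic `w' = -w²/2`, while the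
Jacobian `J` of the flow satisfies `J' = wJ`. Hence `w²J` is conserved until blow-up, and a value
`w₀ < 0` blows up at time `-2/w₀`. The set `I_t` consists of the points that have not blown up by
time `t`, and the claim is that their energy is still present. Characteristics of a weak solution
need not be unique, so the argument is Eulerian: it looks for densities `β(s, w)` with `β_s - (w²/2)
β_w + wβ ≥ 0`, for which `∫ β(s, w(x, s)) dx` should not decrease (`IsEntropyDensity`).

To justify this for weak solutions, `W = κ' * u` is used in place of `w`. At fixed `x` it is
absolutely continuous in time and obeys an explicit ODE (`ae_deriv_mollify`). The commutator
identity `mollify_sq_eq` rewrites that ODE as transport of `W` by `u` with source `½ κ * w²` minus a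
weighted mean square increment of `u`. The increment term tends to `w²`, so the source tends to
`-w²/2`, and the consistency error vanishes in `L¹` (`tendsto_integral_mollifyError`). Since `β_w`
and `β/|w|` are bounded, `integral_forcing_ge` turns this into a lower bound for the entropy
production. The spatial cutoff costs nothing in the limit because `u` grows only like `√|x|`. The
outcome is `integral_entropy_le`.

Two densities are needed, both regularized by a small `e`. The first is `w₊²/(1 + e w₊²)`. The
second is `AB/(eA + B)` with `A = w₋²` and `B = ((1 + (t - s)w/2)₊)²`. Along `w' = -w²/2` both `A`
and `B` satisfy `X' = -wX`, and so does every function of them that is homogeneous of degree one. At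
`s = t` the two densities add up to at most `w²`. At `s = 0` they tend to `w²` restricted to `w >
-2/t` as `e → 0`, and dominated convergence concludes. -/

namespace HunterSaxton

open Filter Topology

/-! ### Functions absolutely continuous on every bounded interval -/

section LocallyAbsolutelyContinuous

variable {f : ℝ → ℝ}

theorem continuous_of_absCont (hf : ∀ a b, AbsolutelyContinuousOnInterval f a b) :
    Continuous f := by
  rw [continuous_iff_continuousAt]
  intro x
  have h := (hf (x - 1) (x + 1)).continuousOn
  rw [uIcc_of_le (by linarith)] at h
  exact h.continuousAt (Icc_mem_nhds (by linarith) (by linarith))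

theorem ae_hasDerivAt_of_absCont (hf : ∀ a b, AbsolutelyContinuousOnInterval f a b) :
    ∀ᵐ x, HasDerivAt f (deriv f x) x := by
  have h : ∀ n : ℕ, ∀ᵐ x, x ∈ uIcc (-(n : ℝ)) n → DifferentiableAt ℝ f x :=
    fun n => (hf _ _).ae_differentiableAt
  filter_upwards [ae_all_iff.2 h] with x hx
  obtain ⟨n, hn⟩ := exists_nat_ge |x|
  refine (hx n ?_).hasDerivAt
  rw [uIcc_of_le (by linarith [abs_nonneg x])]
  exact abs_le.1 hn

/-- Cauchy-Schwarz for increments. -/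
theorem sq_sub_le_mul_integral_sq (hf : ∀ a b, AbsolutelyContinuousOnInterval f a b)
    (h2 : Integrable fun x => deriv f x ^ 2) {a b : ℝ} (hab : a ≤ b) :
    (f b - f a) ^ 2 ≤ (b - a) * ∫ x in a..b, deriv f x ^ 2 := by
  rcases hab.eq_or_lt with rfl | hlt
  · simp
  have hi := (hf a b).intervalIntegrable_deriv
  have hi2 : IntervalIntegrable (fun x => deriv f x ^ 2) volume a b := h2.intervalIntegrable
  -- With `m` the mean slope, expanding `∫ (f' - m)² ≥ 0` gives the inequality.
  set m := (f b - f a) / (b - a) with hm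
  have hpos : 0 < b - a := by linarith
  have h0 : 0 ≤ ∫ x in a..b, (deriv f x - m) ^ 2 :=
    intervalIntegral.integral_nonneg hab fun x _ => sq_nonneg _
  have h1 : ∫ x in a..b, (deriv f x - m) ^ 2
      = (∫ x in a..b, deriv f x ^ 2) - 2 * m * (f b - f a) + m ^ 2 * (b - a) := by
    rw [← (hf a b).integral_deriv_eq_sub]
    have : ∀ x, (deriv f x - m) ^ 2 = deriv f x ^ 2 - 2 * m * deriv f x + m ^ 2 := fun x => by ring
    simp_rw [this]
    rw [intervalIntegral.integral_add (hi2.sub (hi.const_mul _)) (by simp),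
      intervalIntegral.integral_sub hi2 (hi.const_mul _), intervalIntegral.integral_const_mul]
    simp; ring
  have h2 : f b - f a = m * (b - a) := by rw [hm]; field_simp
  rw [h1, h2] at h0
  rw [h2]
  nlinarith

theorem integral_mul_deriv_of_absCont (hf : ∀ a b, AbsolutelyContinuousOnInterval f a b)
    {ψ : ℝ → ℝ} (hψ : ContDiff ℝ 1 ψ) (hc : HasCompactSupport ψ) :
    ∫ x, f x * deriv ψ x = -∫ x, deriv f x * ψ x := by
  obtain ⟨R, hR⟩ := (Metric.isBounded_iff_subset_closedBall 0).1 hc.isCompact.isBounded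
  have hR' : tsupport ψ ⊆ Icc (-R) R := by simpa [Real.closedBall_eq_Icc] using hR
  -- The margin `1` keeps `±S` off the support, so the boundary terms vanish.
  set S := |R| + 1
  have hout : ∀ x, x ∉ Ioo (-S) S → x ∉ tsupport ψ := fun x hx hx' => hx <| by
    have := hR' hx'
    have h1 := le_abs_self R
    exact ⟨by linarith [this.1], by linarith [this.2]⟩
  have h0 : ∀ x, x ∉ Ioo (-S) S → ψ x = 0 := fun x hx => image_eq_zero_of_notMem_tsupport (hout x hx)
  have h0' : ∀ x, x ∉ Ioo (-S) S → deriv ψ x = 0 := fun x hx => by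
    by_contra h
    exact hout x hx (support_deriv_subset (Function.mem_support.2 h))
  have key := (hf (-S) S).integral_mul_deriv_eq_deriv_mul
    (hψ.contDiffOn.absolutelyContinuousOnInterval (a := -S) (b := S))
  rw [h0 S (by simp), h0 (-S) (by simp), intervalIntegral.integral_eq_integral_of_support_subset,
    intervalIntegral.integral_eq_integral_of_support_subset] at key
  · simpa using key
  · intro x hx
    by_contra h
    exact hx (by simp [h0 x fun h' => h (Ioo_subset_Ioc_self h')])
  · intro x hx
    by_contra h
    exact hx (by simp [h0' x fun h' => h (Ioo_subset_Ioc_self h')])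

end LocallyAbsolutelyContinuous

/-! ### Primitives and window averages of integrable functions -/

section Primitive

variable {g : ℝ → ℝ}

theorem absCont_primitive (hg : Integrable g) (a b : ℝ) :
    AbsolutelyContinuousOnInterval (fun x => ∫ y in (0 : ℝ)..x, g y) a b := by
  have h : IntervalIntegrable g volume (min (min a b) 0) (max (max a b) 0) := hg.intervalIntegrable
  refine AbsolutelyContinuousOnInterval.mono
    (h.absolutelyContinuousOnInterval_intervalIntegral (c := 0) ?_) ?_
  · rw [uIcc_of_le (by simp)]; simp
  · rw [uIcc_of_le (a := min (min a b) 0) (by simp)]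
    exact Icc_subset_Icc (min_le_left _ _) (le_max_left _ _)

theorem ae_deriv_primitive (hg : Integrable g) :
    ∀ᵐ x, HasDerivAt (fun x => ∫ y in (0 : ℝ)..x, g y) (g x) x := by
  filter_upwards [LocallyIntegrable.ae_hasDerivAt_integral hg.locallyIntegrable] with x hx using hx 0

theorem integral_primitive_mul_deriv (hg : Integrable g) {ψ : ℝ → ℝ} (hψ : ContDiff ℝ 1 ψ)
    (hc : HasCompactSupport ψ) :
    ∫ x, (∫ y in (0 : ℝ)..x, g y) * deriv ψ x = -∫ x, g x * ψ x := by
  rw [integral_mul_deriv_of_absCont (absCont_primitive hg) hψ hc]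
  congr 1
  apply integral_congr_ae
  filter_upwards [ae_deriv_primitive hg] with x hx
  rw [hx.deriv]

theorem integral_deriv_eq_zero {ψ : ℝ → ℝ} (hψ : ContDiff ℝ 1 ψ) (hc : HasCompactSupport ψ) :
    ∫ x, deriv ψ x = 0 := by
  have := integral_mul_deriv_of_absCont (f := fun _ => 1)
    (fun a b => contDiffOn_const.absolutelyContinuousOnInterval) hψ hc
  simpa using this

/-- The primitives based at `-∞` and at `0` differ by a constant, which `ψ'` annihilates. This turns
the nonlocal source of the equation into the local density `w²`. -/
theorem integral_setIntegral_Iic_mul_deriv (hg : Integrable g) {ψ : ℝ → ℝ} (hψ : ContDiff ℝ 1 ψ)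
    (hc : HasCompactSupport ψ) :
    ∫ x, (∫ y in Iic x, g y) * deriv ψ x = -∫ x, g x * ψ x := by
  have h : ∀ x, (∫ y in Iic x, g y) * deriv ψ x
      = ((∫ y in Iic 0, g y) + ∫ y in (0 : ℝ)..x, g y) * deriv ψ x := fun x => by
    rw [← intervalIntegral.integral_Iic_sub_Iic hg.integrableOn hg.integrableOn]; ring
  have hd : Continuous (deriv ψ) := hψ.continuous_deriv le_rfl
  rw [funext h]
  simp only [add_mul]
  rw [integral_add, integral_primitive_mul_deriv hg hψ hc, integral_const_mul,
    integral_deriv_eq_zero hψ hc]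
  · simp
  · exact (hd.integrable_of_hasCompactSupport hc.deriv).const_mul _
  · refine Continuous.integrable_of_hasCompactSupport ?_ hc.deriv.mul_left
    exact (continuous_of_absCont (absCont_primitive hg)).mul hd

/-- The integral of `g` over the window of radius `ε` about `x`. -/
noncomputable def windowIntegral (g : ℝ → ℝ) (ε x : ℝ) : ℝ := ∫ y in x - ε..x + ε, g y

theorem windowIntegral_eq (hg : Integrable g) (ε x : ℝ) :
    windowIntegral g ε x = (∫ y in (0 : ℝ)..x + ε, g y) - ∫ y in (0 : ℝ)..x - ε, g y :=
  (intervalIntegral.integral_interval_sub_left hg.intervalIntegrable hg.intervalIntegrable).symm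

theorem windowIntegral_nonneg (hg : ∀ x, 0 ≤ g x) {ε : ℝ} (hε : 0 ≤ ε) (x : ℝ) :
    0 ≤ windowIntegral g ε x :=
  intervalIntegral.integral_nonneg (by linarith) fun y _ => hg y

/-- As a convolution, the window integral is integrable with a computable integral. The window `Ioc`
about `x` becomes `Ico` under the reflection `y ↦ x - y`. -/
theorem windowIntegral_eq_convolution {ε : ℝ} (hε : 0 ≤ ε) (x : ℝ) :
    windowIntegral g ε x = convolution g (indicator (Ico (-ε) ε) fun _ => (1 : ℝ))
      (ContinuousLinearMap.mul ℝ ℝ) volume x := by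
  rw [convolution_def, windowIntegral, intervalIntegral.integral_of_le (by linarith),
    ← integral_indicator measurableSet_Ioc]
  congr 1
  ext y
  simp only [indicator, mem_Ioc, mem_Ico, ContinuousLinearMap.mul_apply']
  by_cases h : x - ε < y ∧ y ≤ x + ε
  · rw [if_pos h, if_pos (by constructor <;> linarith [h.1, h.2]), mul_one]
  · rw [if_neg h, if_neg, mul_zero]
    exact fun h' => h (by constructor <;> linarith [h'.1, h'.2])

theorem integrable_indicator_Ico_one (ε : ℝ) :
    Integrable (indicator (Ico (-ε) ε) fun _ => (1 : ℝ)) :=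
  (integrableOn_const (by simp)).integrable_indicator measurableSet_Ico

theorem integrable_windowIntegral (hg : Integrable g) {ε : ℝ} (hε : 0 ≤ ε) :
    Integrable (windowIntegral g ε) := by
  rw [funext (windowIntegral_eq_convolution (g := g) hε)]
  exact hg.integrable_convolution _ (integrable_indicator_Ico_one ε)

theorem integral_windowIntegral (hg : Integrable g) {ε : ℝ} (hε : 0 ≤ ε) :
    ∫ x, windowIntegral g ε x = 2 * ε * ∫ x, g x := by
  rw [funext (windowIntegral_eq_convolution (g := g) hε),
    integral_convolution _ hg (integrable_indicator_Ico_one ε),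
    integral_indicator measurableSet_Ico]
  simp [hε]
  ring

theorem tendsto_windowIntegral_div (hg : Integrable g) {ε : ℕ → ℝ} (hε : ∀ n, 0 < ε n)
    (hε0 : Tendsto ε atTop (𝓝 0)) :
    ∀ᵐ x, Tendsto (fun n => windowIntegral g (ε n) x / ε n) atTop (𝓝 (2 * g x)) := by
  filter_upwards [ae_deriv_primitive hg] with x hx
  rw [hasDerivAt_iff_tendsto_slope_zero] at hx
  have h1 : Tendsto ε atTop (𝓝[≠] 0) :=
    tendsto_nhdsWithin_iff.2 ⟨hε0, .of_forall fun n => (hε n).ne'⟩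
  have h2 : Tendsto (fun n => -ε n) atTop (𝓝[≠] 0) :=
    tendsto_nhdsWithin_iff.2 ⟨by simpa using hε0.neg, .of_forall fun n => by simpa using (hε n).ne'⟩
  rw [two_mul]
  refine ((hx.comp h1).add (hx.comp h2)).congr fun n => ?_
  rw [windowIntegral_eq hg]
  have := (hε n).ne'
  simp only [Function.comp, smul_eq_mul, ← sub_eq_add_neg]
  field_simp
  ring

end Primitive

/-! ### Concentrating kernels and mollifiers -/

section SmallSupport

variable {ε : ℝ}

theorem abs_integral_mul_le_of_support {h k : ℝ → ℝ} {B D : ℝ} (hε : 0 ≤ ε) (hB : 0 ≤ B)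
    (hk : ∀ y, y ∉ Icc (-ε) ε → k y = 0) (hkD : ∀ y, |k y| ≤ D)
    (hh : ∀ y ∈ Icc (-ε) ε, |h y| ≤ B) :
    |∫ y, h y * k y| ≤ 2 * ε * B * D := by
  rw [← setIntegral_eq_integral_of_forall_compl_eq_zero (s := Icc (-ε) ε)
    fun y hy => by rw [hk y hy, mul_zero], ← Real.norm_eq_abs]
  refine (norm_setIntegral_le_of_norm_le_const (C := B * D) measure_Icc_lt_top fun y hy => ?_).trans_eq ?_
  · rw [Real.norm_eq_abs, abs_mul]
    exact mul_le_mul (hh y hy) (hkD y) (abs_nonneg _) hB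
  · simp [max_eq_left (show (0 : ℝ) ≤ ε + ε by linarith)]
    ring

/-- A kernel of height `ε^{-(m+1)}` on an interval of length `2ε` has absolute `m`-th moment bounded
uniformly in `ε`, so it annihilates `o(y^m)` in the limit. It is applied to `κ'` with `m = 1` and to
`κ''` with `m = 2`. -/
theorem tendsto_integral_mul_of_isLittleO {h : ℝ → ℝ} {m : ℕ} {c : ℝ} {ε : ℕ → ℝ}
    {k : ℕ → ℝ → ℝ} (hh : h =o[𝓝 0] fun y => y ^ m) (hε : ∀ n, 0 < ε n)
    (hε0 : Tendsto ε atTop (𝓝 0)) (hk : ∀ n y, y ∉ Icc (-ε n) (ε n) → k n y = 0)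
    (hkc : ∀ n y, |k n y| ≤ c / ε n ^ (m + 1)) :
    Tendsto (fun n => ∫ y, h y * k n y) atTop (𝓝 0) := by
  have hc : 0 ≤ c := by
    have := (abs_nonneg _).trans (hkc 0 0)
    by_contra hc
    exact absurd this (not_le.2 (div_neg_of_neg_of_pos (not_le.1 hc) (pow_pos (hε 0) _)))
  rw [Metric.tendsto_atTop]
  intro δ hδ
  -- The final bound is `δ · 2c/(2c + 1)`; the `+ 1` makes it strictly less than `δ` and covers `c =
  -- 0`.
  have hη : 0 < δ / (2 * c + 1) := by positivity
  obtain ⟨r, hr, hball⟩ := Metric.eventually_nhds_iff.1 (hh.def hη)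
  obtain ⟨N, hN⟩ := Metric.tendsto_atTop.1 hε0 r hr
  refine ⟨N, fun n hn => ?_⟩
  have hεn := hε n
  have hrn : ε n < r := by
    have := hN n hn
    rwa [Real.dist_eq, sub_zero, abs_of_pos hεn] at this
  rw [Real.dist_eq, sub_zero]
  have := abs_integral_mul_le_of_support (h := h) (B := δ / (2 * c + 1) * ε n ^ m) hεn.le
    (by positivity) (hk n) (hkc n) fun y hy => by
      have hy' := abs_le.2 hy
      have h1 := @hball y (by rw [Real.dist_eq, sub_zero]; linarith)
      rw [Real.norm_eq_abs, Real.norm_eq_abs, abs_pow] at h1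
      exact h1.trans (mul_le_mul_of_nonneg_left (pow_le_pow_left₀ (abs_nonneg _) hy' _) hη.le)
  refine this.trans_lt ?_
  have : 2 * ε n * (δ / (2 * c + 1) * ε n ^ m) * (c / ε n ^ (m + 1)) = δ * (2 * c / (2 * c + 1)) := by
    field_simp
    ring
  rw [this]
  have : 2 * c / (2 * c + 1) < 1 := by rw [div_lt_one (by positivity)]; linarith
  nlinarith

end SmallSupport

/-- `κ` is a smooth nonnegative kernel of mass one, supported in `[-ε, ε]`, which together with its
first two derivatives has the size of a rescaled fixed kernel. -/
structure IsMollifier (κ : ℝ → ℝ) (ε c : ℝ) : Prop where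
  contDiff : ContDiff ℝ ∞ κ
  support_subset : Function.support κ ⊆ Icc (-ε) ε
  nonneg : ∀ y, 0 ≤ κ y
  integral_eq_one : ∫ y, κ y = 1
  bound : ∀ y, |κ y| ≤ c / ε
  bound_deriv : ∀ y, |deriv κ y| ≤ c / ε ^ 2
  bound_deriv_deriv : ∀ y, |deriv (deriv κ) y| ≤ c / ε ^ 3

/-- Rescaling one bump function gives a constant `c` that serves all `ε` at once, which is what
makes the later majorants uniform. -/
theorem exists_isMollifier : ∃ c > 0, ∀ ε > 0, ∃ κ, IsMollifier κ ε c := by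
  let b : ContDiffBump (0 : ℝ) := ⟨1 / 2, 1, by norm_num, by norm_num⟩
  set ρ : ℝ → ℝ := b.normed volume
  have hρ : ContDiff ℝ ∞ ρ := b.contDiff_normed
  have hρ1 : ContDiff ℝ ∞ (deriv ρ) := (contDiff_infty_iff_deriv.1 hρ).2
  have hρ2 : ContDiff ℝ ∞ (deriv (deriv ρ)) := (contDiff_infty_iff_deriv.1 hρ1).2
  have hc : HasCompactSupport ρ := b.hasCompactSupport_normed
  obtain ⟨c0, h0⟩ := hc.exists_bound_of_continuous hρ.continuous
  obtain ⟨c1, h1⟩ := hc.deriv.exists_bound_of_continuous hρ1.continuous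
  obtain ⟨c2, h2⟩ := hc.deriv.deriv.exists_bound_of_continuous hρ2.continuous
  refine ⟨|c0| + |c1| + |c2| + 1, by positivity, fun ε hε => ⟨fun y => ε⁻¹ * ρ (ε⁻¹ * y), ?_⟩⟩
  have hd1 : deriv (fun y => ε⁻¹ * ρ (ε⁻¹ * y)) = fun y => ε⁻¹ ^ 2 * deriv ρ (ε⁻¹ * y) := by
    ext y
    rw [deriv_const_mul_field, deriv_comp_mul_left]
    simp only [smul_eq_mul]; ring
  have hd2 : deriv (deriv (fun y => ε⁻¹ * ρ (ε⁻¹ * y)))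
      = fun y => ε⁻¹ ^ 3 * deriv (deriv ρ) (ε⁻¹ * y) := by
    rw [hd1]
    ext y
    rw [deriv_const_mul_field, deriv_comp_mul_left]
    simp only [smul_eq_mul]; ring
  have hbd : ∀ (m : ℕ) (a C : ℝ), |a| ≤ C → |ε⁻¹ ^ m * a| ≤ C / ε ^ m := fun m a C h => by
    rw [abs_mul, abs_of_pos (by positivity), inv_pow, div_eq_inv_mul]
    gcongr
  constructor
  · fun_prop
  · intro y hy
    have : ε⁻¹ * y ∈ Function.support ρ := right_ne_zero_of_mul hy
    rw [b.support_normed_eq] at this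
    have : |ε⁻¹ * y| < 1 := by simpa [b] using this
    rw [abs_mul, abs_of_pos (by positivity), inv_mul_lt_one₀ hε] at this
    exact abs_le.1 this.le
  · intro y
    exact mul_nonneg (by positivity) (b.nonneg_normed _)
  · rw [integral_const_mul, Measure.integral_comp_mul_left, b.integral_normed]
    rw [inv_inv, abs_of_pos hε, smul_eq_mul, mul_one, inv_mul_cancel₀ hε.ne']
  · intro y
    have := hbd 1 (ρ (ε⁻¹ * y)) (|c0| + |c1| + |c2| + 1) (by
      have := (h0 (ε⁻¹ * y)).trans (le_abs_self c0)
      rw [Real.norm_eq_abs] at this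
      linarith [abs_nonneg c1, abs_nonneg c2])
    simpa using this
  · intro y
    rw [hd1]
    refine hbd 2 _ _ ?_
    have := (h1 (ε⁻¹ * y)).trans (le_abs_self c1)
    rw [Real.norm_eq_abs] at this
    linarith [abs_nonneg c0, abs_nonneg c2]
  · intro y
    rw [hd2]
    refine hbd 3 _ _ ?_
    have := (h2 (ε⁻¹ * y)).trans (le_abs_self c2)
    rw [Real.norm_eq_abs] at this
    linarith [abs_nonneg c0, abs_nonneg c1]

namespace IsMollifier

variable {κ : ℝ → ℝ} {ε c : ℝ}

theorem eq_zero (hκ : IsMollifier κ ε c) {y : ℝ} (hy : y ∉ Icc (-ε) ε) : κ y = 0 := by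
  by_contra h
  exact hy (hκ.support_subset h)

theorem tsupport_subset (hκ : IsMollifier κ ε c) : tsupport κ ⊆ Icc (-ε) ε :=
  closure_minimal hκ.support_subset isClosed_Icc

theorem hasCompactSupport (hκ : IsMollifier κ ε c) : HasCompactSupport κ :=
  isCompact_Icc.of_isClosed_subset (isClosed_tsupport κ) hκ.tsupport_subset

theorem deriv_eq_zero (hκ : IsMollifier κ ε c) {y : ℝ} (hy : y ∉ Icc (-ε) ε) :
    deriv κ y = 0 := by
  by_contra h
  exact hy (hκ.tsupport_subset (support_deriv_subset (Function.mem_support.2 h)))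

theorem deriv_deriv_eq_zero (hκ : IsMollifier κ ε c) {y : ℝ} (hy : y ∉ Icc (-ε) ε) :
    deriv (deriv κ) y = 0 := by
  by_contra h
  have h1 : tsupport (deriv κ) ⊆ Icc (-ε) ε := by
    refine closure_minimal (fun z hz => ?_) isClosed_Icc
    by_contra h'
    exact hz (hκ.deriv_eq_zero h')
  exact hy (h1 (support_deriv_subset (Function.mem_support.2 h)))

theorem contDiff_deriv (hκ : IsMollifier κ ε c) : ContDiff ℝ ∞ (deriv κ) :=
  (contDiff_infty_iff_deriv.1 hκ.contDiff).2

theorem contDiff_deriv_deriv (hκ : IsMollifier κ ε c) : ContDiff ℝ ∞ (deriv (deriv κ)) :=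
  (contDiff_infty_iff_deriv.1 hκ.contDiff_deriv).2

theorem contDiff_one (hκ : IsMollifier κ ε c) : ContDiff ℝ 1 κ :=
  hκ.contDiff.of_le (by exact_mod_cast le_top)

theorem contDiff_one_deriv (hκ : IsMollifier κ ε c) : ContDiff ℝ 1 (deriv κ) :=
  hκ.contDiff_deriv.of_le (by exact_mod_cast le_top)

theorem integral_deriv (hκ : IsMollifier κ ε c) : ∫ y, deriv κ y = 0 :=
  integral_deriv_eq_zero hκ.contDiff_one hκ.hasCompactSupport

theorem integral_deriv_deriv (hκ : IsMollifier κ ε c) : ∫ y, deriv (deriv κ) y = 0 :=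
  integral_deriv_eq_zero hκ.contDiff_one_deriv hκ.hasCompactSupport.deriv

/-- This moment of `κ'` and the second moment of `κ''` below identify the limits of `mollify (deriv
κ)` and `incrementMean` at points of differentiability. -/
theorem integral_id_mul_deriv (hκ : IsMollifier κ ε c) : ∫ y, y * deriv κ y = -1 := by
  rw [integral_mul_deriv_of_absCont (f := fun y => y)
    (fun a b => contDiffOn_id.absolutelyContinuousOnInterval) hκ.contDiff_one hκ.hasCompactSupport]
  simp [hκ.integral_eq_one]

theorem integral_sq_mul_deriv_deriv (hκ : IsMollifier κ ε c) :
    ∫ y, y ^ 2 * deriv (deriv κ) y = 2 := by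
  rw [integral_mul_deriv_of_absCont (f := fun y => y ^ 2)
    (fun a b => (contDiff_id.pow 2).contDiffOn.absolutelyContinuousOnInterval)
    hκ.contDiff_one_deriv hκ.hasCompactSupport.deriv]
  simp [mul_assoc, integral_const_mul, hκ.integral_id_mul_deriv]

theorem integrable_mul_deriv (hκ : IsMollifier κ ε c) {h : ℝ → ℝ} (hh : Continuous h) :
    Integrable fun y => h y * deriv κ y :=
  (hh.mul hκ.contDiff_deriv.continuous).integrable_of_hasCompactSupport
    hκ.hasCompactSupport.deriv.mul_left

theorem integrable_mul_deriv_deriv (hκ : IsMollifier κ ε c) {h : ℝ → ℝ} (hh : Continuous h) :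
    Integrable fun y => h y * deriv (deriv κ) y :=
  (hh.mul hκ.contDiff_deriv_deriv.continuous).integrable_of_hasCompactSupport
    hκ.hasCompactSupport.deriv.deriv.mul_left

end IsMollifier

/-- A form of the generalized dominated convergence theorem: a sequence converging to zero almost
everywhere converges in mean if it has integrable majorants which converge almost everywhere and
whose integrals converge to the integral of the limit. -/
theorem tendsto_integral_zero_of_le {α : Type*} [MeasurableSpace α] {μ : Measure α}
    {e M : ℕ → α → ℝ} {m : α → ℝ} (he : ∀ n, AEStronglyMeasurable (e n) μ)
    (he0 : ∀ n x, 0 ≤ e n x) (heM : ∀ n x, e n x ≤ M n x) (hM : ∀ n, Integrable (M n) μ)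
    (hm : Integrable m μ) (hm0 : ∀ x, 0 ≤ m x)
    (hMm : ∀ᵐ x ∂μ, Tendsto (fun n => M n x) atTop (𝓝 (m x)))
    (hint : Tendsto (fun n => ∫ x, M n x ∂μ) atTop (𝓝 (∫ x, m x ∂μ)))
    (hlim : ∀ᵐ x ∂μ, Tendsto (fun n => e n x) atTop (𝓝 0)) :
    Tendsto (fun n => ∫ x, e n x ∂μ) atTop (𝓝 0) := by
  have hei : ∀ n, Integrable (e n) μ := fun n => (hM n).mono' (he n) <| .of_forall fun x => by
    rw [Real.norm_eq_abs, abs_of_nonneg (he0 n x)]; exact heM n x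
  have hA : ∀ n, Integrable (fun x => min (e n x) (m x)) μ := fun n => (hei n).inf hm
  have hB : ∀ n, Integrable (fun x => max (m x - M n x) 0) μ := fun n => (hm.sub (hM n)).pos_part
  have h1 : Tendsto (fun n => ∫ x, min (e n x) (m x) ∂μ) atTop (𝓝 0) := by
    have := tendsto_integral_of_dominated_convergence (μ := μ) (f := fun _ => (0 : ℝ)) m
      (fun n => (hA n).aestronglyMeasurable) hm
      (fun n => .of_forall fun x => by
        rw [Real.norm_eq_abs, abs_of_nonneg (le_min (he0 n x) (hm0 x))]
        exact min_le_right _ _)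
      (hlim.mono fun x hx => by simpa [hm0 x] using hx.min (tendsto_const_nhds (x := m x)))
    simpa using this
  have h2 : Tendsto (fun n => ∫ x, max (m x - M n x) 0 ∂μ) atTop (𝓝 0) := by
    have := tendsto_integral_of_dominated_convergence (μ := μ) (f := fun _ => (0 : ℝ)) m
      (fun n => (hB n).aestronglyMeasurable) hm
      (fun n => .of_forall fun x => by
        rw [Real.norm_eq_abs, abs_of_nonneg (le_max_right _ _)]
        exact max_le (by linarith [he0 n x, heM n x]) (hm0 x))
      (hMm.mono fun x hx => by
        simpa using (tendsto_const_nhds (x := m x)).sub hx |>.max (tendsto_const_nhds (x := (0 : ℝ))))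
    simpa using this
  -- The pointwise bound is `e ≤ min e m + (M - m)₊`, where `(M - m)₊ = (M - m) + (m - M)₊`. The
  -- first and last terms are dominated by `m`; the middle one is handled by convergence of the
  -- integrals.
  have h3 : Tendsto (fun n => (∫ x, min (e n x) (m x) ∂μ) + ((∫ x, M n x ∂μ) - ∫ x, m x ∂μ)
      + ∫ x, max (m x - M n x) 0 ∂μ) atTop (𝓝 0) := by
    simpa using (h1.add (hint.sub_const (∫ x, m x ∂μ))).add h2
  refine squeeze_zero (fun n => integral_nonneg (he0 n)) (fun n => ?_) h3
  have hC : Integrable (fun x => M n x - m x) μ := (hM n).sub hm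
  have hD : Integrable (fun x => min (e n x) (m x) + (M n x - m x)) μ := (hA n).add hC
  rw [← integral_sub (hM n) hm, ← integral_add (hA n) hC, ← integral_add hD (hB n)]
  refine integral_mono (hei n) (hD.add (hB n)) fun x => ?_
  have := heM n x
  rcases le_total (e n x) (m x) with h | h <;> rcases le_total (m x - M n x) 0 with h' | h' <;>
    simp only [min_eq_left h, min_eq_right h, max_eq_left h', max_eq_right h'] <;> linarith

/-! ### Mollification and the commutator -/

/-- The convolution of `f` with the kernel `k`. -/
noncomputable def mollify (k f : ℝ → ℝ) (x : ℝ) : ℝ := ∫ y, f (x - y) * k y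

/-- The weighted mean square increment which arises as commutator of mollification and transport. -/
noncomputable def incrementMean (k f : ℝ → ℝ) (x : ℝ) : ℝ :=
  (1 / 2) * ∫ y, (f (x - y) - f x) ^ 2 * k y

theorem mollify_eq_integral_mul_sub (k f : ℝ → ℝ) (x : ℝ) :
    mollify k f x = ∫ y, f y * k (x - y) := by
  rw [mollify, ← integral_sub_left_eq_self (fun y => f y * k (x - y)) volume x]
  simp

theorem hasDerivAt_mollify {k f : ℝ → ℝ} (hk : ContDiff ℝ 1 k) (hc : HasCompactSupport k)
    (hf : Continuous f) (x : ℝ) : HasDerivAt (mollify k f) (mollify (deriv k) f x) x := by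
  have h : ∀ k : ℝ → ℝ, mollify k f = convolution k f (ContinuousLinearMap.mul ℝ ℝ) volume := by
    intro k
    ext x
    simp only [mollify, convolution_def, ContinuousLinearMap.mul_apply', mul_comm]
  rw [h k, h (deriv k)]
  exact hc.hasDerivAt_convolution_left _ hk hf.locallyIntegrable x

theorem continuous_mollify {k f : ℝ → ℝ} (hk : ContDiff ℝ 1 k) (hc : HasCompactSupport k)
    (hf : Continuous f) : Continuous (mollify k f) :=
  continuous_iff_continuousAt.2 fun x => (hasDerivAt_mollify hk hc hf x).continuousAt

namespace IsMollifier

variable {κ : ℝ → ℝ} {ε c : ℝ}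

theorem contDiff_one_deriv_deriv (hκ : IsMollifier κ ε c) : ContDiff ℝ 1 (deriv (deriv κ)) :=
  hκ.contDiff_deriv_deriv.of_le (by exact_mod_cast le_top)

/-- An integration by parts. It reduces continuity and convergence of `κ * g`, for `g` merely
integrable, to the corresponding facts for `κ'` and the continuous primitive of `g`. -/
theorem mollify_eq_mollify_deriv (hκ : IsMollifier κ ε c) {g : ℝ → ℝ} (hg : Integrable g) :
    mollify κ g = mollify (deriv κ) (fun x => ∫ y in (0 : ℝ)..x, g y) := by
  ext x
  have h1 : ContDiff ℝ 1 fun y => κ (x - y) := hκ.contDiff_one.comp (contDiff_const.sub contDiff_id)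
  have h2 : HasCompactSupport fun y => κ (x - y) :=
    hκ.hasCompactSupport.comp_homeomorph (Homeomorph.subLeft x)
  have := integral_primitive_mul_deriv hg h1 h2
  simp_rw [deriv_comp_const_sub, mul_neg] at this
  rw [integral_neg, neg_inj] at this
  rw [mollify_eq_integral_mul_sub, mollify_eq_integral_mul_sub, this]

theorem continuous_mollify_deriv (hκ : IsMollifier κ ε c) {f : ℝ → ℝ} (hf : Continuous f) :
    Continuous (mollify (deriv κ) f) :=
  continuous_mollify hκ.contDiff_one_deriv hκ.hasCompactSupport.deriv hf

theorem continuous_mollify_deriv_deriv (hκ : IsMollifier κ ε c) {f : ℝ → ℝ} (hf : Continuous f) :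
    Continuous (mollify (deriv (deriv κ)) f) :=
  continuous_mollify hκ.contDiff_one_deriv_deriv hκ.hasCompactSupport.deriv.deriv hf

theorem continuous_mollify_of_integrable (hκ : IsMollifier κ ε c) {g : ℝ → ℝ}
    (hg : Integrable g) : Continuous (mollify κ g) := by
  rw [hκ.mollify_eq_mollify_deriv hg]
  exact hκ.continuous_mollify_deriv (continuous_of_absCont (absCont_primitive hg))

theorem mollify_deriv_eq (hκ : IsMollifier κ ε c) {f : ℝ → ℝ} (hf : Continuous f) (x : ℝ) :
    mollify (deriv κ) f x = ∫ y, (f (x - y) - f x) * deriv κ y := by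
  simp_rw [sub_mul]
  rw [integral_sub (hκ.integrable_mul_deriv (by fun_prop))
    (hκ.integrable_mul_deriv (h := fun _ => f x) (by fun_prop)), integral_const_mul,
    hκ.integral_deriv, mul_zero, sub_zero, mollify]

/-- The commutator identity. -/
theorem mollify_sq_eq (hκ : IsMollifier κ ε c) {f : ℝ → ℝ} (hf : Continuous f) (x : ℝ) :
    (1 / 2) * mollify (deriv (deriv κ)) (fun y => f y ^ 2) x
      = f x * mollify (deriv (deriv κ)) f x + incrementMean (deriv (deriv κ)) f x := by
  have h : ∀ y, (f (x - y) - f x) ^ 2 * deriv (deriv κ) y = f (x - y) ^ 2 * deriv (deriv κ) y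
      - 2 * f x * (f (x - y) * deriv (deriv κ) y) + f x ^ 2 * deriv (deriv κ) y := fun y => by ring
  have i1 : Integrable fun y => f (x - y) ^ 2 * deriv (deriv κ) y :=
    hκ.integrable_mul_deriv_deriv (h := fun y => f (x - y) ^ 2) (by fun_prop)
  have i2 : Integrable fun y => 2 * f x * (f (x - y) * deriv (deriv κ) y) :=
    (hκ.integrable_mul_deriv_deriv (h := fun y => f (x - y)) (by fun_prop)).const_mul _
  have i3 : Integrable fun y => f x ^ 2 * deriv (deriv κ) y :=
    hκ.integrable_mul_deriv_deriv (h := fun y => f x ^ 2) (by fun_prop)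
  have i4 : Integrable fun y => f (x - y) ^ 2 * deriv (deriv κ) y
      - 2 * f x * (f (x - y) * deriv (deriv κ) y) := i1.sub i2
  rw [incrementMean, integral_congr_ae (.of_forall h), integral_add i4 i3,
    integral_sub i1 i2, integral_const_mul, integral_const_mul, hκ.integral_deriv_deriv, mollify,
    mollify]
  ring

section Estimates

variable {f : ℝ → ℝ}

theorem increment_sq_le (hf : ∀ a b, AbsolutelyContinuousOnInterval f a b)
    (h2 : Integrable fun x => deriv f x ^ 2) (hε : 0 < ε) (x : ℝ) {y : ℝ} (hy : y ∈ Icc (-ε) ε) :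
    (f (x - y) - f x) ^ 2 ≤ ε * windowIntegral (fun x => deriv f x ^ 2) ε x := by
  have key : ∀ a b, a ≤ b → x - ε ≤ a → b ≤ x + ε → b - a ≤ ε →
      (f b - f a) ^ 2 ≤ ε * windowIntegral (fun x => deriv f x ^ 2) ε x := by
    intro a b hab ha hb hba
    refine (sq_sub_le_mul_integral_sq hf h2 hab).trans ?_
    refine mul_le_mul hba ?_ (intervalIntegral.integral_nonneg hab fun _ _ => sq_nonneg _) hε.le
    rw [windowIntegral]
    exact intervalIntegral.integral_mono_interval ha hab hb (.of_forall fun _ => sq_nonneg _)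
      h2.intervalIntegrable
  rcases le_total 0 y with h | h
  · have := key (x - y) x (by linarith) (by linarith [hy.2]) (by linarith) (by linarith [hy.2])
    linarith [sq_nonneg (f (x - y) - f x), show (f x - f (x - y)) ^ 2 = (f (x - y) - f x) ^ 2 by ring]
  · exact key x (x - y) (by linarith) (by linarith) (by linarith [hy.1]) (by linarith [hy.1])

/-- Since `∫ κ' = 0`, only increments of `f` enter, each at most `√(εN)` with `N` the window
integral. Squaring `2ε · √(εN) · c/ε²` gives the constant. Window averages are used as majorants
because they converge almost everywhere and their integrals do not depend on `ε`. -/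
theorem sq_mollify_deriv_le (hκ : IsMollifier κ ε c) (hε : 0 < ε)
    (hf : ∀ a b, AbsolutelyContinuousOnInterval f a b)
    (h2 : Integrable fun x => deriv f x ^ 2) (x : ℝ) :
    mollify (deriv κ) f x ^ 2 ≤ 4 * c ^ 2 * (windowIntegral (fun x => deriv f x ^ 2) ε x / ε) := by
  set N := windowIntegral (fun x => deriv f x ^ 2) ε x
  have hN : 0 ≤ N := windowIntegral_nonneg (fun _ => sq_nonneg _) hε.le x
  have := abs_integral_mul_le_of_support (h := fun y => f (x - y) - f x) (B := √(ε * N)) hε.le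
    (Real.sqrt_nonneg _) (fun y => hκ.deriv_eq_zero) hκ.bound_deriv fun y hy =>
      Real.abs_le_sqrt (increment_sq_le hf h2 hε x hy)
  rw [← hκ.mollify_deriv_eq (continuous_of_absCont hf)] at this
  have h3 := pow_le_pow_left₀ (abs_nonneg _) this 2
  rw [sq_abs, mul_pow, mul_pow, Real.sq_sqrt (by positivity)] at h3
  refine h3.trans_eq ?_
  field_simp
  ring

theorem abs_incrementMean_le (hκ : IsMollifier κ ε c) (hε : 0 < ε)
    (hf : ∀ a b, AbsolutelyContinuousOnInterval f a b)
    (h2 : Integrable fun x => deriv f x ^ 2) (x : ℝ) :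
    |incrementMean (deriv (deriv κ)) f x|
      ≤ c * (windowIntegral (fun x => deriv f x ^ 2) ε x / ε) := by
  set N := windowIntegral (fun x => deriv f x ^ 2) ε x
  have hN : 0 ≤ N := windowIntegral_nonneg (fun _ => sq_nonneg _) hε.le x
  have := abs_integral_mul_le_of_support (h := fun y => (f (x - y) - f x) ^ 2) (B := ε * N) hε.le
    (by positivity) (fun y => hκ.deriv_deriv_eq_zero) hκ.bound_deriv_deriv fun y hy => by
      rw [abs_of_nonneg (sq_nonneg _)]
      exact increment_sq_le hf h2 hε x hy
  rw [incrementMean, abs_mul]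
  -- The square of the increment gains a full power of `ε`, which compensates the extra derivative
  -- on `κ`.
  have h3 : 2 * ε * (ε * N) * (c / ε ^ 3) = 2 * (c * (N / ε)) := by field_simp
  rw [h3] at this
  rw [abs_of_pos (by norm_num : (0 : ℝ) < 1 / 2)]
  linarith

theorem mollify_nonneg (hκ : IsMollifier κ ε c) {g : ℝ → ℝ} (hg : ∀ x, 0 ≤ g x) (x : ℝ) :
    0 ≤ mollify κ g x :=
  integral_nonneg fun y => mul_nonneg (hg _) (hκ.nonneg y)

theorem mollify_le (hκ : IsMollifier κ ε c) (hε : 0 < ε) {g : ℝ → ℝ} (hg : ∀ x, 0 ≤ g x)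
    (hgi : Integrable g) (x : ℝ) : mollify κ g x ≤ c * (windowIntegral g ε x / ε) := by
  have hN : windowIntegral g ε x = ∫ y in Icc (-ε) ε, g (x - y) := by
    rw [windowIntegral, integral_Icc_eq_integral_Ioc, ← intervalIntegral.integral_of_le (by linarith),
      intervalIntegral.integral_comp_sub_left]
    congr 1; ring
  rw [hN, mollify, ← setIntegral_eq_integral_of_forall_compl_eq_zero (s := Icc (-ε) ε)
    fun y hy => by rw [hκ.eq_zero hy, mul_zero]]
  have hi : Integrable fun y => g (x - y) := hgi.comp_sub_left x
  have : c * ((∫ y in Icc (-ε) ε, g (x - y)) / ε) = ∫ y in Icc (-ε) ε, g (x - y) * (c / ε) := by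
    rw [integral_mul_const]; ring
  rw [this]
  refine integral_mono_of_nonneg (.of_forall fun y => mul_nonneg (hg _) (hκ.nonneg y))
    (hi.mul_const _).integrableOn (.of_forall fun y => ?_)
  exact mul_le_mul_of_nonneg_left ((le_abs_self _).trans (hκ.bound y)) (hg _)

end Estimates

end IsMollifier

/-! ### Consistency of the mollified equation -/

section Limits

variable {f : ℝ → ℝ} {κ : ℕ → ℝ → ℝ} {ε : ℕ → ℝ} {c : ℝ}

theorem isLittleO_increment {g x : ℝ} (hx : HasDerivAt f g x) :
    (fun y => f (x - y) - f x + g * y) =o[𝓝 0] fun y => y := by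
  have h := hasDerivAt_iff_isLittleO.1 hx
  have ht : Tendsto (fun y : ℝ => x - y) (𝓝 0) (𝓝 x) := by
    have : Continuous fun y : ℝ => x - y := by fun_prop
    simpa using this.tendsto 0
  have h2 := h.comp_tendsto ht
  refine (h2.congr (fun y => ?_) (fun y => ?_) (g₂ := fun y => -y)).of_neg_right
  · simp; ring
  · simp

theorem tendsto_mollify_deriv (hf : Continuous f) (hκ : ∀ n, IsMollifier (κ n) (ε n) c)
    (hε : ∀ n, 0 < ε n) (hε0 : Tendsto ε atTop (𝓝 0)) {g x : ℝ} (hx : HasDerivAt f g x) :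
    Tendsto (fun n => mollify (deriv (κ n)) f x) atTop (𝓝 g) := by
  have h0 := tendsto_integral_mul_of_isLittleO (m := 1) (k := fun n => deriv (κ n)) (c := c)
    (by simpa using isLittleO_increment hx) hε hε0 (fun n y => (hκ n).deriv_eq_zero)
    (fun n => (hκ n).bound_deriv)
  have h1 : ∀ n, mollify (deriv (κ n)) f x
      = g + ∫ y, (f (x - y) - f x + g * y) * deriv (κ n) y := fun n => by
    rw [(hκ n).mollify_deriv_eq hf]
    simp_rw [add_mul _ (g * _), mul_assoc]
    rw [integral_add ((hκ n).integrable_mul_deriv (h := fun y => f (x - y) - f x) (by fun_prop))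
      (((hκ n).integrable_mul_deriv (h := fun y => y) (by fun_prop)).const_mul g),
      integral_const_mul, (hκ n).integral_id_mul_deriv]
    ring
  simp_rw [h1]
  simpa using h0.const_add g

theorem tendsto_incrementMean (hf : Continuous f) (hκ : ∀ n, IsMollifier (κ n) (ε n) c)
    (hε : ∀ n, 0 < ε n) (hε0 : Tendsto ε atTop (𝓝 0)) {g x : ℝ} (hx : HasDerivAt f g x) :
    Tendsto (fun n => incrementMean (deriv (deriv (κ n))) f x) atTop (𝓝 (g ^ 2)) := by
  have ho : (fun y => (f (x - y) - f x) ^ 2 - g ^ 2 * y ^ 2) =o[𝓝 0] fun y => y ^ 2 := by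
    have h1 := isLittleO_increment hx
    have h2 : (fun y => f (x - y) - f x - g * y) =O[𝓝 0] fun y => y := by
      have h3 : (fun y : ℝ => 2 * g * y) =O[𝓝 0] fun y => y :=
        (Asymptotics.isBigO_refl _ _).const_mul_left _
      exact (h1.isBigO.sub h3).congr_left fun y => by ring
    -- The difference of squares factors as `o(y) · O(y)`.
    exact (h1.mul_isBigO h2).congr (fun y => by ring) (fun y => by ring)
  have h0 := tendsto_integral_mul_of_isLittleO (m := 2) (k := fun n => deriv (deriv (κ n))) (c := c)
    ho hε hε0 (fun n y => (hκ n).deriv_deriv_eq_zero) (fun n => (hκ n).bound_deriv_deriv)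
  have h1 : ∀ n, incrementMean (deriv (deriv (κ n))) f x
      = g ^ 2 + 1 / 2 * ∫ y, ((f (x - y) - f x) ^ 2 - g ^ 2 * y ^ 2) * deriv (deriv (κ n)) y := by
    intro n
    rw [incrementMean]
    simp_rw [sub_mul _ (g ^ 2 * _), mul_assoc (g ^ 2)]
    rw [integral_sub
      ((hκ n).integrable_mul_deriv_deriv (h := fun y => (f (x - y) - f x) ^ 2) (by fun_prop))
      (((hκ n).integrable_mul_deriv_deriv (h := fun y => y ^ 2) (by fun_prop)).const_mul _),
      integral_const_mul, (hκ n).integral_sq_mul_deriv_deriv]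
    ring
  simp_rw [h1]
  simpa only [mul_zero, add_zero] using (h0.const_mul (1 / 2)).const_add (g ^ 2)

/-- The consistency error of the mollified transport equation. -/
noncomputable def mollifyError (κ f : ℝ → ℝ) (x : ℝ) : ℝ :=
  |(1 / 2) * mollify (deriv κ) f x ^ 2 + (1 / 2) * mollify κ (fun y => deriv f y ^ 2) x
      - incrementMean (deriv (deriv κ)) f x|
    + |deriv f x - mollify (deriv κ) f x| * |mollify (deriv κ) f x|

theorem mollifyError_nonneg (κ f : ℝ → ℝ) (x : ℝ) : 0 ≤ mollifyError κ f x := by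
  rw [mollifyError]; positivity

theorem mollifyError_le {κ : ℝ → ℝ} {ε : ℝ} (hκ : IsMollifier κ ε c) (hε : 0 < ε)
    (hf : ∀ a b, AbsolutelyContinuousOnInterval f a b)
    (h2 : Integrable fun x => deriv f x ^ 2) (x : ℝ) :
    mollifyError κ f x ≤ (8 * c ^ 2 + 2 * c) *
      (windowIntegral (fun x => deriv f x ^ 2) ε x / ε) + deriv f x ^ 2 := by
  have h1 := hκ.sq_mollify_deriv_le hε hf h2 x
  have h3 := abs_le.1 (hκ.abs_incrementMean_le hε hf h2 x)
  have h4 := hκ.mollify_le hε (fun _ => sq_nonneg _) h2 x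
  have h5 := hκ.mollify_nonneg (g := fun y => deriv f y ^ 2) (fun _ => sq_nonneg _) x
  rw [mollifyError]
  set W := mollify (deriv κ) f x
  set N := windowIntegral (fun x => deriv f x ^ 2) ε x / ε
  have hW := sq_nonneg W
  have h6 : |(1 / 2) * W ^ 2 + (1 / 2) * mollify κ (fun y => deriv f y ^ 2) x
      - incrementMean (deriv (deriv κ)) f x| ≤ 2 * c ^ 2 * N + 2 * (c * N) :=
    abs_le.2 ⟨by linarith, by linarith⟩
  -- Young's inequality. With `W² ≤ 4c²N` the term `3/2 W²` contributes `6c²N`, which together with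
  -- the `2c²N` of `h6` makes `8c²N`.
  have h7 : |deriv f x - W| * |W| ≤ deriv f x ^ 2 + 3 / 2 * W ^ 2 := by
    have := abs_sub (deriv f x) W
    have e1 := sq_abs (deriv f x)
    have e2 := sq_abs W
    nlinarith [abs_nonneg W, sq_nonneg (|deriv f x| - |W|), sq_nonneg (|deriv f x|)]
  linarith

theorem integrable_mollifyError {κ : ℝ → ℝ} {ε : ℝ} (hκ : IsMollifier κ ε c) (hε : 0 < ε)
    (hf : ∀ a b, AbsolutelyContinuousOnInterval f a b)
    (h2 : Integrable fun x => deriv f x ^ 2) : Integrable (mollifyError κ f) := by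
  have hfc := continuous_of_absCont hf
  have hW : Continuous (mollify (deriv κ) f) := hκ.continuous_mollify_deriv hfc
  have hQ : Continuous (mollify κ fun y => deriv f y ^ 2) := hκ.continuous_mollify_of_integrable h2
  -- Continuity is read off the commutator identity.
  have hT : Continuous (incrementMean (deriv (deriv κ)) f) := by
    have : incrementMean (deriv (deriv κ)) f = fun x =>
        (1 / 2) * mollify (deriv (deriv κ)) (fun y => f y ^ 2) x
          - f x * mollify (deriv (deriv κ)) f x := by
      ext x; linarith [hκ.mollify_sq_eq hfc x]
    rw [this]
    exact (continuous_const.mul (hκ.continuous_mollify_deriv_deriv (hfc.pow 2))).sub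
      (hfc.mul (hκ.continuous_mollify_deriv_deriv hfc))
  have hm : Measurable (mollifyError κ f) := by
    have hd : Measurable (deriv f) := measurable_deriv f
    have h1 := hW.measurable
    have h2 := hQ.measurable
    have h3 := hT.measurable
    have e : mollifyError κ f = fun x => _ := rfl
    simp only [mollifyError] at e
    rw [e]
    simp only [← Real.norm_eq_abs]
    fun_prop
  refine Integrable.mono' ((((integrable_windowIntegral h2 hε.le).div_const ε).const_mul
    (8 * c ^ 2 + 2 * c)).add h2) hm.aestronglyMeasurable (.of_forall fun x => ?_)
  rw [Real.norm_eq_abs, abs_of_nonneg (mollifyError_nonneg _ _ _)]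
  exact mollifyError_le hκ hε hf h2 x

theorem integral_mollifyError_le {κ : ℝ → ℝ} {ε : ℝ} (hκ : IsMollifier κ ε c) (hε : 0 < ε)
    (hf : ∀ a b, AbsolutelyContinuousOnInterval f a b)
    (h2 : Integrable fun x => deriv f x ^ 2) :
    ∫ x, mollifyError κ f x ≤ (16 * c ^ 2 + 4 * c + 1) * ∫ x, deriv f x ^ 2 := by
  have hN := ((integrable_windowIntegral h2 hε.le).div_const ε).const_mul (8 * c ^ 2 + 2 * c)
  refine (integral_mono (integrable_mollifyError hκ hε hf h2) (hN.add h2)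
    (mollifyError_le hκ hε hf h2)).trans_eq ?_
  simp only [Pi.add_apply]
  rw [integral_add hN h2, integral_const_mul, integral_div, integral_windowIntegral h2 hε.le]
  field_simp
  ring

theorem integral_sq_mollify_deriv_le {κ : ℝ → ℝ} {ε : ℝ} (hκ : IsMollifier κ ε c) (hε : 0 < ε)
    (hf : ∀ a b, AbsolutelyContinuousOnInterval f a b)
    (h2 : Integrable fun x => deriv f x ^ 2) :
    Integrable (fun x => mollify (deriv κ) f x ^ 2) ∧
      ∫ x, mollify (deriv κ) f x ^ 2 ≤ 8 * c ^ 2 * ∫ x, deriv f x ^ 2 := by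
  have hN := ((integrable_windowIntegral h2 hε.le).div_const ε).const_mul (4 * c ^ 2)
  have hi : Integrable (fun x => mollify (deriv κ) f x ^ 2) := by
    refine Integrable.mono' hN ?_ (.of_forall fun x => ?_)
    · exact ((hκ.continuous_mollify_deriv (continuous_of_absCont hf)).pow 2).aestronglyMeasurable
    · rw [Real.norm_eq_abs, abs_of_nonneg (sq_nonneg _)]
      exact hκ.sq_mollify_deriv_le hε hf h2 x
  refine ⟨hi, (integral_mono hi hN (hκ.sq_mollify_deriv_le hε hf h2)).trans_eq ?_⟩
  rw [integral_const_mul, integral_div, integral_windowIntegral h2 hε.le]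
  field_simp
  ring

/-- At almost every `x` the first bracket tends to `½w² + ½w² - w² = 0` and the product to `0`. The
majorants vary with `n`, but they converge almost everywhere and have constant integral, so the
generalized dominated convergence theorem applies. -/
theorem tendsto_integral_mollifyError (hf : ∀ a b, AbsolutelyContinuousOnInterval f a b)
    (h2 : Integrable fun x => deriv f x ^ 2) (hκ : ∀ n, IsMollifier (κ n) (ε n) c)
    (hε : ∀ n, 0 < ε n) (hε0 : Tendsto ε atTop (𝓝 0)) (hc : 0 ≤ c) :
    Tendsto (fun n => ∫ x, mollifyError (κ n) f x) atTop (𝓝 0) := by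
  have hfc := continuous_of_absCont hf
  have hN := fun n => ((integrable_windowIntegral h2 (hε n).le).div_const (ε n)).const_mul
    (8 * c ^ 2 + 2 * c)
  have hm : Integrable fun x => (8 * c ^ 2 + 2 * c) * (2 * deriv f x ^ 2) + deriv f x ^ 2 :=
    ((h2.const_mul 2).const_mul _).add h2
  refine tendsto_integral_zero_of_le
    (fun n => (integrable_mollifyError (hκ n) (hε n) hf h2).aestronglyMeasurable)
    (fun n x => mollifyError_nonneg _ _ _) (fun n => mollifyError_le (hκ n) (hε n) hf h2)
    (fun n => (hN n).add h2) hm (fun x => by positivity) ?_ ?_ ?_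
  · filter_upwards [tendsto_windowIntegral_div h2 hε hε0] with x hx
    exact (hx.const_mul _).add_const _
  · refine tendsto_const_nhds.congr fun n => ?_
    have := (hε n).ne'
    rw [integral_add (hN n) h2, integral_const_mul, integral_div,
      integral_windowIntegral h2 (hε n).le,
      integral_add ((h2.const_mul 2).const_mul _) h2, integral_const_mul, integral_const_mul]
    field_simp
  · filter_upwards [ae_hasDerivAt_of_absCont hf, ae_deriv_primitive h2] with x hx hx2
    have t1 := tendsto_mollify_deriv hfc hκ hε hε0 hx
    have t2 := tendsto_incrementMean hfc hκ hε hε0 hx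
    have t3 := tendsto_mollify_deriv (continuous_of_absCont (absCont_primitive h2)) hκ hε hε0 hx2
    have t3' : Tendsto (fun n => mollify (κ n) (fun y => deriv f y ^ 2) x) atTop
        (𝓝 (deriv f x ^ 2)) :=
      t3.congr fun n => by rw [(hκ n).mollify_eq_mollify_deriv h2]
    have := ((((t1.pow 2).const_mul (1 / 2)).add (t3'.const_mul (1 / 2))).sub t2).abs.add
      (((tendsto_const_nhds (x := deriv f x)).sub t1).abs.mul t1.abs)
    rw [show 1 / 2 * deriv f x ^ 2 + 1 / 2 * deriv f x ^ 2 - deriv f x ^ 2 = 0 by ring, sub_self,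
      abs_zero, zero_mul, add_zero] at this
    exact this

end Limits

/-! ### Entropy densities and their production -/

theorem integrable_deriv_and_integral_eq_zero {P : ℝ → ℝ}
    (hP : ∀ a b, AbsolutelyContinuousOnInterval P a b) (hc : HasCompactSupport P) :
    Integrable (deriv P) ∧ ∫ x, deriv P x = 0 := by
  obtain ⟨R, hR⟩ := (Metric.isBounded_iff_subset_closedBall 0).1 hc.isCompact.isBounded
  have hR' : tsupport P ⊆ Icc (-R) R := by simpa [Real.closedBall_eq_Icc] using hR
  set S := |R| + 1
  have hS : tsupport P ⊆ Ioo (-S) S := fun x hx => by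
    have := hR' hx
    have h1 := le_abs_self R
    exact ⟨by linarith [this.1], by linarith [this.2]⟩
  have h0 : ∀ x, x ∉ Ioo (-S) S → P x = 0 := fun x hx =>
    image_eq_zero_of_notMem_tsupport fun h => hx (hS h)
  have hsupp : Function.support (deriv P) ⊆ Ioc (-S) S :=
    support_deriv_subset.trans (hS.trans Ioo_subset_Ioc_self)
  constructor
  · have h := (hP (-S) S).intervalIntegrable_deriv
    rw [intervalIntegrable_iff_integrableOn_Ioc_of_le (by linarith [abs_nonneg R])] at h
    exact (integrableOn_iff_integrable_of_support_subset hsupp).1 h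
  · rw [← intervalIntegral.integral_eq_integral_of_support_subset hsupp,
      (hP (-S) S).integral_deriv_eq_sub, h0 S (by simp), h0 (-S) (by simp), sub_zero]

/-- A bounded density `β(s, w)` whose integral does not decrease along solutions of the transport
equation `∂ₜw + u ∂ₓw = -w²/2`, `∂ₓu = w` for times `s ∈ [0, T]`; `βs` and `βw` are the partial
derivatives. -/
structure IsEntropyDensity (T K : ℝ) (β βs βw : ℝ → ℝ → ℝ) : Prop where
  hasDerivAt_comp : ∀ s ∈ Icc 0 T, ∀ (y : ℝ → ℝ) (y' : ℝ), HasDerivAt y y' s →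
    HasDerivAt (fun r => β r (y r)) (βs s (y s) + βw s (y s) * y') s
  hasDerivAt : ∀ s ∈ Icc 0 T, ∀ w, HasDerivAt (β s) (βw s w) w
  measurable_left : Measurable (Function.uncurry βs)
  measurable_right : Measurable (Function.uncurry βw)
  supersolution : ∀ s ∈ Icc 0 T, ∀ w, 0 ≤ βs s w - (1 / 2) * w ^ 2 * βw s w + w * β s w
  abs_left_le : ∀ s ∈ Icc 0 T, ∀ w, |βs s w| ≤ K * |w|
  abs_right_le : ∀ s ∈ Icc 0 T, ∀ w, |βw s w| ≤ K
  nonneg : ∀ s ∈ Icc 0 T, ∀ w, 0 ≤ β s w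
  le_sq : ∀ s ∈ Icc 0 T, ∀ w, β s w ≤ w ^ 2
  le_const : ∀ s ∈ Icc 0 T, ∀ w, β s w ≤ K
  le_abs : ∀ s ∈ Icc 0 T, ∀ w, β s w ≤ K * |w|

/-- The time derivative of the mollified spatial derivative of a solution, in terms of a time
slice `f` of the solution. -/
noncomputable def mollifiedForcing (κ f : ℝ → ℝ) (x : ℝ) : ℝ :=
  -((1 / 2) * mollify (deriv (deriv κ)) (fun y => f y ^ 2) x)
    + (1 / 2) * mollify κ (fun y => deriv f y ^ 2) x

namespace IsEntropyDensity

variable {T K : ℝ} {β βs βw : ℝ → ℝ → ℝ}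

theorem continuous_right (hβ : IsEntropyDensity T K β βs βw) {s : ℝ} (hs : s ∈ Icc 0 T) :
    Continuous (β s) :=
  continuous_iff_continuousAt.2 fun w => (hβ.hasDerivAt s hs w).continuousAt

theorem lipschitzWith_right (hβ : IsEntropyDensity T K β βs βw) {s : ℝ} (hs : s ∈ Icc 0 T) :
    LipschitzWith K.toNNReal (β s) := by
  refine lipschitzWith_of_nnnorm_deriv_le (fun w => (hβ.hasDerivAt s hs w).differentiableAt)
    fun w => ?_
  rw [(hβ.hasDerivAt s hs w).deriv, ← NNReal.coe_le_coe, coe_nnnorm, Real.norm_eq_abs]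
  exact (hβ.abs_right_le s hs w).trans (Real.le_coe_toNNReal K)

/-- Subtracting the exact derivative of the flux `χ f β(s, W)` costs nothing after integration. By
the commutator identity what remains is the supersolution expression at `W`, which is nonnegative,
up to the consistency error (controlled by `|β_w| ≤ K` and `β ≤ K|W|`) and a cutoff term (controlled
by `|χ' f| ≤ D` and `β ≤ W²`). -/
theorem integral_forcing_ge (hβ : IsEntropyDensity T K β βs βw) {s : ℝ} (hs : s ∈ Icc 0 T)
    {κ f χ : ℝ → ℝ} {ε c D : ℝ} (hκ : IsMollifier κ ε c) (hε : 0 < ε)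
    (hf : ∀ a b, AbsolutelyContinuousOnInterval f a b)
    (h2 : Integrable fun x => deriv f x ^ 2) (hχ : ContDiff ℝ 1 χ) (hχc : HasCompactSupport χ)
    (hχ0 : ∀ x, 0 ≤ χ x) (hχ1 : ∀ x, χ x ≤ 1) (hD : ∀ x, |deriv χ x * f x| ≤ D) :
    -(K * ∫ x, mollifyError κ f x) - D * ∫ x, mollify (deriv κ) f x ^ 2
      ≤ ∫ x, χ x * (βs s (mollify (deriv κ) f x)
          + βw s (mollify (deriv κ) f x) * mollifiedForcing κ f x) := by
  have hfc := continuous_of_absCont hf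
  set W := mollify (deriv κ) f with hWdef
  have hWd : ∀ x, HasDerivAt W (mollify (deriv (deriv κ)) f x) x :=
    hasDerivAt_mollify hκ.contDiff_one_deriv hκ.hasCompactSupport.deriv hfc
  have hWc : Continuous W := hκ.continuous_mollify_deriv hfc
  have hW1 : ContDiff ℝ 1 W := by
    refine contDiff_one_iff_deriv.2 ⟨fun x => (hWd x).differentiableAt, ?_⟩
    rw [funext fun x => (hWd x).deriv]
    exact hκ.continuous_mollify_deriv_deriv hfc
  have hK : 0 ≤ K := (abs_nonneg _).trans (hβ.abs_right_le s hs 0)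
  set P : ℝ → ℝ := fun x => χ x * f x * β s (W x)
  have hPac : ∀ a b, AbsolutelyContinuousOnInterval P a b := fun a b => by
    obtain ⟨L, hL⟩ := hW1.contDiffOn.exists_lipschitzOnWith (s := uIcc a b) (by decide)
      (convex_Icc _ _) isCompact_Icc
    exact (hχ.contDiffOn.absolutelyContinuousOnInterval.fun_mul (hf a b)).fun_mul
      ((hβ.lipschitzWith_right hs).comp_lipschitzOnWith hL).absolutelyContinuousOnInterval
  obtain ⟨hPi, hP0⟩ := integrable_deriv_and_integral_eq_zero hPac
    (hχc.mul_right.mul_right (f' := fun x => β s (W x)))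
  have hPd : ∀ᵐ x, deriv P x = deriv χ x * f x * β s (W x) + χ x * deriv f x * β s (W x)
      + χ x * f x * (βw s (W x) * mollify (deriv (deriv κ)) f x) := by
    filter_upwards [ae_hasDerivAt_of_absCont hf] with x hx
    have h1 := (((hχ.differentiable one_ne_zero x).hasDerivAt.mul hx).mul
      ((hβ.hasDerivAt s hs (W x)).comp x (hWd x))).deriv
    refine Eq.trans h1 ?_
    simp only [Function.comp, Pi.mul_apply]
    ring
  have hGc : Continuous (mollifiedForcing κ f) :=
    ((continuous_const.mul (hκ.continuous_mollify_deriv_deriv (hfc.pow 2))).neg).add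
      (continuous_const.mul (hκ.continuous_mollify_of_integrable h2))
  have hL : Integrable fun x => χ x * (βs s (W x) + βw s (W x) * mollifiedForcing κ f x) := by
    have hb : Integrable fun x => χ x * (K * |W x| + K * |mollifiedForcing κ f x|) :=
      Continuous.integrable_of_hasCompactSupport (by have := hχ.continuous; fun_prop) hχc.mul_right
    refine hb.mono' (Measurable.aestronglyMeasurable ?_) (.of_forall fun x => ?_)
    · have e1 : Measurable fun x => βs s (W x) :=
        hβ.measurable_left.comp (measurable_const.prodMk hWc.measurable)
      have e2 : Measurable fun x => βw s (W x) :=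
        hβ.measurable_right.comp (measurable_const.prodMk hWc.measurable)
      exact hχ.continuous.measurable.mul (e1.add (e2.mul hGc.measurable))
    · rw [Real.norm_eq_abs, abs_mul, abs_of_nonneg (hχ0 x)]
      refine mul_le_mul_of_nonneg_left ((abs_add_le _ _).trans ?_) (hχ0 x)
      rw [abs_mul]
      exact add_le_add (hβ.abs_left_le s hs _)
        (mul_le_mul_of_nonneg_right (hβ.abs_right_le s hs _) (abs_nonneg _))
  have hE := integrable_mollifyError hκ hε hf h2
  have hW2 := (integral_sq_mollify_deriv_le hκ hε hf h2).1
  have hR : Integrable fun x => -(K * mollifyError κ f x) - D * W x ^ 2 - deriv P x :=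
    ((hE.const_mul K).neg.sub (hW2.const_mul D)).sub hPi
  have hint : ∫ x, (-(K * mollifyError κ f x) - D * W x ^ 2 - deriv P x)
      = -(K * ∫ x, mollifyError κ f x) - D * ∫ x, W x ^ 2 := by
    have i1 : Integrable fun x => -(K * mollifyError κ f x) := (hE.const_mul K).neg
    have i2 : Integrable fun x => D * W x ^ 2 := hW2.const_mul D
    have i3 : Integrable fun x => -(K * mollifyError κ f x) - D * W x ^ 2 := i1.sub i2
    rw [integral_sub i3 hPi, integral_sub i1 i2, integral_neg, integral_const_mul,
      integral_const_mul, hP0, sub_zero]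
  rw [← hint]
  refine integral_mono_ae hR hL ?_
  filter_upwards [hPd] with x hx
  rw [hx]
  have hG : mollifiedForcing κ f x = -(f x * mollify (deriv (deriv κ)) f x)
      - incrementMean (deriv (deriv κ)) f x
      + (1 / 2) * mollify κ (fun y => deriv f y ^ 2) x := by
    rw [mollifiedForcing, hκ.mollify_sq_eq hfc]; ring
  have hsup := hβ.supersolution s hs (W x)
  set b := β s (W x)
  set bw := βw s (W x)
  -- `Z` is the amount by which the source in the equation for `W` differs from `-W²/2`.
  set Z := (1 / 2) * W x ^ 2 + (1 / 2) * mollify κ (fun y => deriv f y ^ 2) x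
      - incrementMean (deriv (deriv κ)) f x with hZ
  have hb0 : 0 ≤ b := hβ.nonneg s hs _
  have e1 : -(K * |Z|) ≤ bw * Z := by
    have := abs_mul bw Z
    have h3 := mul_le_mul_of_nonneg_right (hβ.abs_right_le s hs (W x)) (abs_nonneg Z)
    linarith [neg_abs_le (bw * Z)]
  -- The flux derivative produces `f' β`, whereas the supersolution inequality contains `W β`.
  have e2 : -(K * (|deriv f x - W x| * |W x|)) ≤ (deriv f x - W x) * b := by
    have h3 := mul_le_mul_of_nonneg_left (hβ.le_abs s hs (W x)) (abs_nonneg (deriv f x - W x))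
    have h4 := neg_abs_le ((deriv f x - W x) * b)
    rw [abs_mul, abs_of_nonneg hb0] at h4
    linarith
  have e3 : -(D * W x ^ 2) ≤ deriv χ x * f x * b := by
    have h4 := neg_abs_le (deriv χ x * f x * b)
    rw [abs_mul, abs_of_nonneg hb0] at h4
    have h5 := mul_le_mul (hD x) (hβ.le_sq s hs (W x)) hb0 ((abs_nonneg _).trans (hD x))
    linarith
  have hE' : mollifyError κ f x = |Z| + |deriv f x - W x| * |W x| := rfl
  have e4 : χ x * (-(K * mollifyError κ f x)) ≥ -(K * mollifyError κ f x) := by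
    have := mul_nonneg hK (mollifyError_nonneg κ f x)
    nlinarith [hχ1 x]
  have e5 : -(K * mollifyError κ f x) - f x * (bw * mollify (deriv (deriv κ)) f x) - deriv f x * b
      ≤ βs s (W x) + bw * mollifiedForcing κ f x := by
    have : bw * mollifiedForcing κ f x = bw * Z - (1 / 2) * W x ^ 2 * bw
        - f x * (bw * mollify (deriv (deriv κ)) f x) := by
      rw [hG, hZ]; ring
    rw [this, hE']
    linarith
  have e6 := mul_le_mul_of_nonneg_left e5 (hχ0 x)
  linarith

end IsEntropyDensity

/-! ### The two truncated densities -/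

theorem hasDerivAt_max_zero_sq (x : ℝ) :
    HasDerivAt (fun y : ℝ => max y 0 ^ 2) (2 * max x 0) x := by
  rcases lt_trichotomy x 0 with h | rfl | h
  · rw [max_eq_right h.le, mul_zero]
    refine (hasDerivAt_const x (0 : ℝ)).congr_of_eventuallyEq ?_
    filter_upwards [Iio_mem_nhds h] with y hy
    simp [max_eq_right (le_of_lt (mem_Iio.1 hy))]
  · rw [hasDerivAt_iff_isLittleO]
    have h1 : (fun y : ℝ => max y 0 ^ 2) =O[𝓝 0] fun y => y ^ 2 :=
      Asymptotics.IsBigO.of_bound 1 <| .of_forall fun y => by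
        rw [one_mul, Real.norm_eq_abs, Real.norm_eq_abs, abs_of_nonneg (sq_nonneg _),
          abs_of_nonneg (sq_nonneg _)]
        rcases le_total y 0 with h | h
        · simpa [max_eq_right h] using sq_nonneg y
        · simp [max_eq_left h]
    have h2 : (fun y : ℝ => y ^ 2) =o[𝓝 0] fun y => y := by
      simpa using Asymptotics.isLittleO_pow_pow (𝕜 := ℝ) (show 1 < 2 by norm_num)
    simpa using h1.trans_isLittleO h2
  · rw [max_eq_left h.le]
    have := hasDerivAt_pow 2 x
    simp only [Nat.cast_ofNat, Nat.add_one_sub_one, pow_one] at this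
    refine this.congr_of_eventuallyEq ?_
    filter_upwards [Ioi_mem_nhds h] with y hy
    rw [max_eq_left (le_of_lt (mem_Ioi.1 hy))]

/-- The truncation of `w²` for positive `w`. -/
noncomputable def posDensity (e w : ℝ) : ℝ := max w 0 ^ 2 / (1 + e * max w 0 ^ 2)

theorem hasDerivAt_posDensity {e : ℝ} (he : 0 ≤ e) (w : ℝ) :
    HasDerivAt (posDensity e) (2 * max w 0 / (1 + e * max w 0 ^ 2) ^ 2) w := by
  have h := hasDerivAt_max_zero_sq w
  have hne : 1 + e * max w 0 ^ 2 ≠ 0 := by positivity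
  refine (h.div ((h.const_mul e).const_add 1) hne).congr_deriv ?_
  congr 1
  ring

/-- The function `w²` satisfies the entropy relation with equality. For `w ≥ 0` truncation leaves
the excess `w³ · e w²/(1 + e w²)² ≥ 0`. For `w < 0` this excess would have the wrong sign, so
negative values need a different density. -/
theorem isEntropyDensity_posDensity {e T : ℝ} (he : 0 < e) (he1 : e ≤ 1) :
    IsEntropyDensity T (2 / e) (fun _ => posDensity e) (fun _ _ => 0)
      (fun _ w => 2 * max w 0 / (1 + e * max w 0 ^ 2) ^ 2) := by
  have hK : 2 ≤ 2 / e := by rw [le_div_iff₀ he]; linarith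
  have hnn : ∀ w, 0 ≤ posDensity e w := fun w => by rw [posDensity]; positivity
  have hbd : ∀ a : ℝ, 0 ≤ a → a / (1 + e * a ^ 2) ≤ 1 / e := fun a ha => by
    rw [div_le_div_iff₀ (by positivity) he]
    nlinarith [mul_nonneg he.le (sq_nonneg (a - 1)), mul_nonneg he.le ha]
  constructor
  · intro s _ y y' hy
    exact ((hasDerivAt_posDensity he.le (y s)).comp s hy).congr_deriv (by ring)
  · intro s _ w
    exact hasDerivAt_posDensity he.le w
  · exact measurable_const
  · unfold Function.uncurry
    fun_prop
  · intro s _ w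
    rcases le_total w 0 with h | h
    · simp [posDensity, max_eq_right h]
    · simp only [posDensity, max_eq_left h]
      have : 0 - 1 / 2 * w ^ 2 * (2 * w / (1 + e * w ^ 2) ^ 2) + w * (w ^ 2 / (1 + e * w ^ 2))
          = w ^ 3 * (e * w ^ 2) / (1 + e * w ^ 2) ^ 2 := by
        field_simp; ring
      rw [this]
      positivity
  · intro s _ w
    simp; positivity
  · intro s _ w
    have ha : 0 ≤ max w 0 := le_max_right _ _
    rw [abs_of_nonneg (by positivity)]
    have h1 : 2 * max w 0 / (1 + e * max w 0 ^ 2) ^ 2 ≤ 2 * (max w 0 / (1 + e * max w 0 ^ 2)) := by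
      rw [mul_div_assoc]
      refine mul_le_mul_of_nonneg_left (div_le_div_of_nonneg_left ha (by positivity) ?_) zero_le_two
      nlinarith [mul_nonneg he.le (sq_nonneg (max w 0))]
    refine h1.trans ((mul_le_mul_of_nonneg_left (hbd _ ha) zero_le_two).trans_eq (by ring))
  · exact fun s _ => hnn
  · intro s _ w
    rw [posDensity, div_le_iff₀ (by positivity)]
    rcases le_total w 0 with h | h
    · simp only [max_eq_right h]; nlinarith [sq_nonneg w]
    · simp only [max_eq_left h]
      nlinarith [mul_nonneg he.le (mul_nonneg (sq_nonneg w) (sq_nonneg w))]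
  · intro s _ w
    rw [posDensity, div_le_div_iff₀ (by positivity) he]
    nlinarith [mul_nonneg he.le (sq_nonneg (max w 0))]
  · intro s _ w
    have ha : 0 ≤ max w 0 := le_max_right _ _
    have hw : max w 0 ≤ |w| := max_le (le_abs_self w) (abs_nonneg w)
    have h1 : posDensity e w = max w 0 / (1 + e * max w 0 ^ 2) * max w 0 := by
      rw [posDensity]; ring
    rw [h1]
    refine mul_le_mul ((hbd _ ha).trans ?_) hw ha (by positivity)
    gcongr; norm_num

theorem hasDerivAt_mul_div_add {A B : ℝ → ℝ} {A' B' e x : ℝ} (hA : HasDerivAt A A' x)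
    (hB : HasDerivAt B B' x) (h : e * A x + B x ≠ 0) :
    HasDerivAt (fun y => A y * B y / (e * A y + B y))
      ((A' * B x ^ 2 + e * A x ^ 2 * B') / (e * A x + B x) ^ 2) x := by
  refine ((hA.mul hB).div ((hA.const_mul e).add hB) h).congr_deriv ?_
  congr 1
  simp only [Pi.mul_apply, Pi.add_apply]
  ring

/-- The truncation of `w²` to the negative `w` which survive for more than the time `σ` under
`w' = -w²/2`. -/
noncomputable def negDensity (e σ w : ℝ) : ℝ :=
  max (-w) 0 ^ 2 * max (1 + σ * w / 2) 0 ^ 2 / (e * max (-w) 0 ^ 2 + max (1 + σ * w / 2) 0 ^ 2)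

theorem negDensity_denom_pos {e σ : ℝ} (he : 0 < e) (hσ : 0 ≤ σ) (w : ℝ) :
    0 < e * max (-w) 0 ^ 2 + max (1 + σ * w / 2) 0 ^ 2 := by
  rcases lt_or_ge w 0 with h | h
  · have : 0 < max (-w) 0 := lt_max_of_lt_left (by linarith)
    positivity
  · have : 0 < max (1 + σ * w / 2) 0 := lt_max_of_lt_left (by positivity)
    positivity

/-- Letting `σ` and `y` both move covers the derivative along curves (`σ' = -1`) and the partial
derivative in `w` (`σ' = 0`) with one formula. -/
theorem hasDerivAt_negDensity {e : ℝ} {σ y : ℝ → ℝ} {σ' y' s : ℝ} (he : 0 < e) (hσ0 : 0 ≤ σ s)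
    (hσ : HasDerivAt σ σ' s) (hy : HasDerivAt y y' s) :
    HasDerivAt (fun r => negDensity e (σ r) (y r))
      ((-(2 * max (-y s) 0 * y') * (max (1 + σ s * y s / 2) 0 ^ 2) ^ 2
        + e * (max (-y s) 0 ^ 2) ^ 2 * (max (1 + σ s * y s / 2) 0 * (σ' * y s + σ s * y')))
        / (e * max (-y s) 0 ^ 2 + max (1 + σ s * y s / 2) 0 ^ 2) ^ 2) s := by
  have hA := (hasDerivAt_max_zero_sq (-y s)).comp s hy.neg
  have hB := (hasDerivAt_max_zero_sq (1 + σ s * y s / 2)).comp s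
    (((hσ.mul hy).div_const 2).const_add 1)
  refine (hasDerivAt_mul_div_add hA hB (negDensity_denom_pos he hσ0 (y s)).ne').congr_deriv ?_
  simp only [Function.comp, Pi.mul_apply, Pi.neg_apply]
  congr 1
  ring

/-- Here `a` stands for `w₋` and `b` for `(1 + σw/2)₊`, which is at most `1` when `w < 0`. The first
two quotients occur in the partial derivatives of the density and the third is the density divided
by `|w|`. -/
theorem negDensity_bounds {e : ℝ} (he : 0 < e) (he1 : e ≤ 1)
    {a b : ℝ} (ha : 0 ≤ a) (hb : 0 ≤ b) (hb1 : b ≤ 1) (hab : 0 < e * a ^ 2 + b ^ 2) :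
    a * b ^ 4 / (e * a ^ 2 + b ^ 2) ^ 2 ≤ 1 / e ∧ a ^ 4 / (e * a ^ 2 + b ^ 2) ^ 2 ≤ 1 / e ^ 2 ∧
      a * b ^ 2 / (e * a ^ 2 + b ^ 2) ≤ 1 / e := by
  have hb2 : b ^ 2 ≤ 1 := by nlinarith
  have h3 : a * b ^ 2 / (e * a ^ 2 + b ^ 2) ≤ 1 / e := by
    rw [div_le_div_iff₀ hab he]
    have : a * b ^ 2 * e ≤ e * a ^ 2 + b ^ 2 := by
      rcases le_total a 1 with h | h
      · have : a * b ^ 2 * e ≤ 1 * b ^ 2 * 1 := by gcongr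
        nlinarith [mul_nonneg he.le (sq_nonneg a)]
      · have : a * b ^ 2 * e ≤ a * 1 * e := by gcongr
        nlinarith [mul_nonneg he.le (mul_nonneg ha (sub_nonneg.2 h)), sq_nonneg b]
    linarith
  refine ⟨?_, ?_, h3⟩
  · have : a * b ^ 4 / (e * a ^ 2 + b ^ 2) ^ 2
        = a * b ^ 2 / (e * a ^ 2 + b ^ 2) * (b ^ 2 / (e * a ^ 2 + b ^ 2)) := by
      field_simp
    rw [this]
    have h4 : b ^ 2 / (e * a ^ 2 + b ^ 2) ≤ 1 := by
      rw [div_le_one hab]; nlinarith [mul_nonneg he.le (sq_nonneg a)]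
    calc _ ≤ 1 / e * 1 := by gcongr
      _ = 1 / e := mul_one _
  · rw [div_le_div_iff₀ (by positivity) (by positivity)]
    have : e * a ^ 2 ≤ e * a ^ 2 + b ^ 2 := by nlinarith [sq_nonneg b]
    have := pow_le_pow_left₀ (by positivity) this 2
    nlinarith

/-- With `σ = T - s`, the factor `1 + σw/2` evolves by `-w/2` times itself along `w' = -w²/2`, so
its square and `w²` both satisfy `X' = -wX`. The density `AB/(eA + B)` is homogeneous of degree one
in these squares and inherits the relation. It is at most `min(A, B/e)`, hence bounded where `w <
0`, and it vanishes where `w ≥ 0`. -/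
theorem isEntropyDensity_negDensity {e T : ℝ} (he : 0 < e) (he1 : e ≤ 1) (hT : 0 ≤ T) :
    IsEntropyDensity T ((2 + T) / e) (fun s => negDensity e (T - s))
      (fun s w => -(e * (max (-w) 0 ^ 2) ^ 2 * (max (1 + (T - s) * w / 2) 0 * w))
        / (e * max (-w) 0 ^ 2 + max (1 + (T - s) * w / 2) 0 ^ 2) ^ 2)
      (fun s w => (-(2 * max (-w) 0) * (max (1 + (T - s) * w / 2) 0 ^ 2) ^ 2
        + e * (max (-w) 0 ^ 2) ^ 2 * (max (1 + (T - s) * w / 2) 0 * (T - s)))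
        / (e * max (-w) 0 ^ 2 + max (1 + (T - s) * w / 2) 0 ^ 2) ^ 2) := by
  have hK : 1 / e ≤ (2 + T) / e := by gcongr; linarith
  have hK0 : 0 ≤ (2 + T) / e := by positivity
  have key : ∀ s ∈ Icc 0 T, ∀ w < 0, 0 ≤ max (1 + (T - s) * w / 2) 0 ∧
      max (1 + (T - s) * w / 2) 0 ≤ 1 := fun s hs w hw =>
    ⟨le_max_right _ _, max_le (by nlinarith [hs.2]) zero_le_one⟩
  have hpos : ∀ s ∈ Icc 0 T, ∀ w, 0 < e * max (-w) 0 ^ 2 + max (1 + (T - s) * w / 2) 0 ^ 2 :=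
    fun s hs w => negDensity_denom_pos he (by linarith [hs.2]) w
  have hzero : ∀ s w, 0 ≤ w → negDensity e (T - s) w = 0 := fun s w hw => by
    simp [negDensity, hw]
  have hnn : ∀ s ∈ Icc 0 T, ∀ w, 0 ≤ negDensity e (T - s) w := fun s hs w => by
    have := hpos s hs w
    rw [negDensity]; positivity
  constructor
  · intro s hs y y' hy
    have hσ : HasDerivAt (fun r => T - r) (-1) s := (hasDerivAt_id s).const_sub T
    refine (hasDerivAt_negDensity he (by linarith [hs.2]) hσ hy).congr_deriv ?_
    field_simp
    ring
  · intro s hs w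
    have := hasDerivAt_negDensity (σ := fun _ => T - s) he (by linarith [hs.2])
      (hasDerivAt_const w (T - s)) (hasDerivAt_id w)
    refine this.congr_deriv ?_
    simp only [id]
    congr 1
    ring
  · unfold Function.uncurry
    fun_prop
  · unfold Function.uncurry
    fun_prop
  · intro s hs w
    rcases le_or_gt 0 w with hw | hw
    · simp [hzero s w hw, hw]
    · have hp := hpos s hs w
      simp only [negDensity]
      rw [max_eq_left (a := -w) (by linarith)] at hp ⊢
      rcases le_total (1 + (T - s) * w / 2) 0 with h | h
      · simp [max_eq_right h]
      · rw [max_eq_left h] at hp ⊢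
        -- By homogeneity the entropy relation is an equality here.
        refine le_of_eq ?_
        field_simp
        ring
  · intro s hs w
    rcases le_or_gt 0 w with hw | hw
    · simp only [max_eq_right (neg_nonpos.2 hw)]
      simp; positivity
    · obtain ⟨hb0, hb1⟩ := key s hs w hw
      have hp := hpos s hs w
      have ha0 : 0 ≤ max (-w) 0 := le_max_right _ _
      set a := max (-w) 0
      set b := max (1 + (T - s) * w / 2) 0
      obtain ⟨-, h2, -⟩ := negDensity_bounds he he1 ha0 hb0 hb1 hp
      have : -(e * (a ^ 2) ^ 2 * (b * w)) / (e * a ^ 2 + b ^ 2) ^ 2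
          = -(e * (a ^ 4 / (e * a ^ 2 + b ^ 2) ^ 2) * b * w) := by ring
      rw [this, abs_neg, abs_mul, abs_of_nonneg (by positivity)]
      refine mul_le_mul_of_nonneg_right ?_ (abs_nonneg w)
      calc _ ≤ e * (1 / e ^ 2) * 1 := by gcongr
        _ = 1 / e := by field_simp
        _ ≤ _ := hK
  · intro s hs w
    rcases le_or_gt 0 w with hw | hw
    · simp only [max_eq_right (neg_nonpos.2 hw)]
      simp; positivity
    · obtain ⟨hb0, hb1⟩ := key s hs w hw
      have hp := hpos s hs w
      have ha0 : 0 ≤ max (-w) 0 := le_max_right _ _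
      have hσ : 0 ≤ T - s := by linarith [hs.2]
      have hσT : T - s ≤ T := by linarith [hs.1]
      set a := max (-w) 0
      set b := max (1 + (T - s) * w / 2) 0
      obtain ⟨h1, h2, -⟩ := negDensity_bounds he he1 ha0 hb0 hb1 hp
      have : (-(2 * a) * (b ^ 2) ^ 2 + e * (a ^ 2) ^ 2 * (b * (T - s))) / (e * a ^ 2 + b ^ 2) ^ 2
          = -(2 * (a * b ^ 4 / (e * a ^ 2 + b ^ 2) ^ 2))
            + e * (a ^ 4 / (e * a ^ 2 + b ^ 2) ^ 2) * b * (T - s) := by ring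
      rw [this]
      refine (abs_add_le _ _).trans ?_
      rw [abs_neg, abs_of_nonneg (by positivity), abs_of_nonneg (by positivity)]
      calc _ ≤ 2 * (1 / e) + e * (1 / e ^ 2) * 1 * T := by gcongr
        _ = (2 + T) / e := by field_simp
  · exact hnn
  · intro s hs w
    have hp := hpos s hs w
    rw [negDensity, div_le_iff₀ hp]
    have h1 : max (-w) 0 ^ 2 ≤ w ^ 2 := by
      rcases le_total w 0 with h | h
      · rw [max_eq_left (by linarith)]; simp
      · rw [max_eq_right (by linarith)]; simpa using sq_nonneg w
    have := mul_le_mul_of_nonneg_right h1 (sq_nonneg (max (1 + (T - s) * w / 2) 0))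
    have := mul_nonneg (sq_nonneg w) (mul_nonneg he.le (sq_nonneg (max (-w) 0)))
    linarith
  · intro s hs w
    rcases le_or_gt 0 w with hw | hw
    · simpa only [hzero s w hw] using hK0
    · obtain ⟨hb0, hb1⟩ := key s hs w hw
      have hp := hpos s hs w
      refine le_trans ?_ hK
      rw [negDensity, div_le_div_iff₀ hp he]
      have hb2 : max (1 + (T - s) * w / 2) 0 ^ 2 ≤ 1 := pow_le_one₀ hb0 hb1
      have := mul_le_mul_of_nonneg_left hb2 (mul_nonneg he.le (sq_nonneg (max (-w) 0)))
      nlinarith [sq_nonneg (max (1 + (T - s) * w / 2) 0)]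
  · intro s hs w
    rcases le_or_gt 0 w with hw | hw
    · simp only [hzero s w hw]; positivity
    · obtain ⟨hb0, hb1⟩ := key s hs w hw
      have hp := hpos s hs w
      have ha0 : 0 ≤ max (-w) 0 := le_max_right _ _
      have ha : max (-w) 0 = |w| := by rw [abs_of_neg hw, max_eq_left (by linarith)]
      rw [negDensity]
      set b := max (1 + (T - s) * w / 2) 0
      obtain ⟨-, -, h3⟩ := negDensity_bounds he he1 ha0 hb0 hb1 hp
      rw [ha] at h3 ⊢
      have : |w| ^ 2 * b ^ 2 / (e * |w| ^ 2 + b ^ 2)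
          = |w| * b ^ 2 / (e * |w| ^ 2 + b ^ 2) * |w| := by ring
      rw [this]
      exact mul_le_mul_of_nonneg_right (h3.trans hK) (abs_nonneg w)

/-- The two truncations together stay below `w²`. -/
theorem posDensity_add_negDensity_mem_Icc {e σ w : ℝ} (he : 0 < e) (he1 : e ≤ 1) (hσ : 0 ≤ σ) :
    posDensity e w + negDensity e σ w ∈ Icc 0 (w ^ 2) := by
  -- Taking the horizon `T = σ` and the time `s = 0` specializes the bounds to `negDensity e σ`.
  have h0 : (0 : ℝ) ∈ Icc (0 : ℝ) σ := ⟨le_rfl, hσ⟩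
  have hn := isEntropyDensity_negDensity he he1 hσ
  have hp := isEntropyDensity_posDensity (T := σ) he he1
  have n0 := hn.nonneg 0 h0 w
  have n1 := hn.le_sq 0 h0 w
  have p0 := hp.nonneg 0 h0 w
  have p1 := hp.le_sq 0 h0 w
  rw [sub_zero] at n0 n1
  refine ⟨add_nonneg p0 n0, ?_⟩
  rcases le_total w 0 with h | h
  · simpa [posDensity, h] using n1
  · simpa [negDensity, h] using p1

/-- The condition `w > -2/t` says `1 + tw/2 > 0`. In that case `B > 0` and `AB/(eA + B) → A`;
otherwise `B = 0` and the negative density vanishes for every `n`. -/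
theorem tendsto_posDensity_add_negDensity {e : ℕ → ℝ} (he : Tendsto e atTop (𝓝 0)) {t : ℝ}
    (ht : 0 < t) (w : ℝ) :
    Tendsto (fun n => posDensity (e n) w + negDensity (e n) t w) atTop
      (𝓝 (if -2 / t < w then w ^ 2 else 0)) := by
  have hp : Tendsto (fun n => posDensity (e n) w) atTop (𝓝 (max w 0 ^ 2)) := by
    have h : Tendsto (fun n => posDensity (e n) w) atTop
        (𝓝 (max w 0 ^ 2 / (1 + 0 * max w 0 ^ 2))) :=
      tendsto_const_nhds.div ((he.mul_const (max w 0 ^ 2)).const_add 1) (by simp)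
    simpa using h
  have hiff : -2 / t < w ↔ 0 < 1 + t * w / 2 := by
    rw [div_lt_iff₀ ht]; constructor <;> intro h <;> linarith
  split_ifs with h
  · have hq := hiff.1 h
    have hn : Tendsto (fun n => negDensity (e n) t w) atTop (𝓝 (max (-w) 0 ^ 2)) := by
      have hq2 : max (1 + t * w / 2) 0 ^ 2 ≠ 0 := by rw [max_eq_left hq.le]; positivity
      have h : Tendsto (fun n => negDensity (e n) t w) atTop
          (𝓝 (max (-w) 0 ^ 2 * max (1 + t * w / 2) 0 ^ 2
            / (0 * max (-w) 0 ^ 2 + max (1 + t * w / 2) 0 ^ 2))) :=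
        tendsto_const_nhds.div ((he.mul_const _).add_const _) (by rwa [zero_mul, zero_add])
      rw [zero_mul, zero_add, mul_div_assoc, div_self hq2, mul_one] at h
      exact h
    convert hp.add hn using 2
    rcases le_total w 0 with h | h <;> simp [h]
  · have hq : 1 + t * w / 2 ≤ 0 := not_lt.1 fun h' => h (hiff.2 h')
    have hw : w ≤ 0 := by nlinarith
    simpa [negDensity, hq, hw] using hp

/-! ### Time slices and the weak formulation -/

/-- Absolute continuity passes along any bound of increments. It serves pairings of the `L²`-valued
curve with a test function (`c₂ = 0`) and compositions `β(s, W(s))`, where `c₂` accounts for the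
explicit time dependence. -/
theorem absCont_of_dist_le {X Y : Type*} [PseudoMetricSpace X] [PseudoMetricSpace Y]
    {F : ℝ → X} {h : ℝ → Y} {a b c₁ c₂ : ℝ} (hF : AbsolutelyContinuousOnInterval F a b)
    (hd : ∀ r ∈ uIcc a b, ∀ s ∈ uIcc a b,
      dist (h r) (h s) ≤ c₁ * dist (F r) (F s) + c₂ * dist r s) :
    AbsolutelyContinuousOnInterval h a b := by
  have hid : AbsolutelyContinuousOnInterval (fun s : ℝ => s) a b :=
    contDiffOn_id.absolutelyContinuousOnInterval
  have hsum := (Tendsto.const_mul c₁ hF).add (Tendsto.const_mul c₂ hid)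
  rw [mul_zero, mul_zero, add_zero] at hsum
  refine squeeze_zero' (.of_forall fun _ => Finset.sum_nonneg fun _ _ => dist_nonneg) ?_ hsum
  filter_upwards [mem_inf_of_right (mem_principal_self _)] with E hE
  rw [Finset.mul_sum, Finset.mul_sum, ← Finset.sum_add_distrib]
  exact Finset.sum_le_sum fun i hi => hd _ (hE.1 i hi).1 _ (hE.1 i hi).2

theorem lintegral_ofReal_le_of_tendsto {F : ℕ → ℝ → ℝ} {f : ℝ → ℝ} {C : ℝ≥0∞}
    (hF : ∀ n, Measurable (F n)) (hC : ∀ n, ∫⁻ x, ENNReal.ofReal (F n x) ≤ C)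
    (hf : ∀ᵐ x, Tendsto (fun n => F n x) atTop (𝓝 (f x))) :
    ∫⁻ x, ENNReal.ofReal (f x) ≤ C := by
  calc ∫⁻ x, ENNReal.ofReal (f x)
      = ∫⁻ x, liminf (fun n => ENNReal.ofReal (F n x)) atTop := lintegral_congr_ae <| by
        filter_upwards [hf] with x hx using (ENNReal.tendsto_ofReal hx).liminf_eq.symm
    _ ≤ liminf (fun n => ∫⁻ x, ENNReal.ofReal (F n x)) atTop :=
        lintegral_liminf_le fun n => (hF n).ennreal_ofReal
    _ ≤ C := liminf_le_of_frequently_le' (.of_forall hC)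

/-- Difference quotients are bounded in `L²` by the derivative. -/
theorem lintegral_sq_differenceQuotient_le {f : ℝ → ℝ}
    (hf : ∀ a b, AbsolutelyContinuousOnInterval f a b)
    (h2 : Integrable fun x => deriv f x ^ 2) {h : ℝ} (hh : 0 < h) :
    ∫⁻ x, ENNReal.ofReal (((f (x + h) - f x) / h) ^ 2)
      ≤ ENNReal.ofReal (∫ x, deriv f x ^ 2) := by
  set N := windowIntegral (fun x => deriv f x ^ 2) (h / 2)
  have hNi : Integrable fun x => N (x + h / 2) / h :=
    ((integrable_windowIntegral h2 (by positivity)).comp_add_right (h / 2)).div_const h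
  have hN : ∫ x, N (x + h / 2) / h = ∫ x, deriv f x ^ 2 := by
    rw [integral_div, integral_add_right_eq_self N, integral_windowIntegral h2 (by positivity)]
    field_simp
  have hle : ∀ x, ((f (x + h) - f x) / h) ^ 2 ≤ N (x + h / 2) / h := fun x => by
    have := sq_sub_le_mul_integral_sq hf h2 (show x ≤ x + h by linarith)
    have e : N (x + h / 2) = ∫ y in x..x + h, deriv f y ^ 2 := by
      simp only [N, windowIntegral]
      congr 1 <;> ring
    rw [e, div_pow, div_le_div_iff₀ (by positivity) hh]
    nlinarith
  rw [← hN, ofReal_integral_eq_lintegral_ofReal hNi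
    (.of_forall fun x => (sq_nonneg _).trans (hle x))]
  exact lintegral_mono fun x => ENNReal.ofReal_le_ofReal (hle x)

theorem tendsto_differenceQuotient {f : ℝ → ℝ} {f' x : ℝ} (hx : HasDerivAt f f' x) :
    Tendsto (fun n : ℕ => (f (x + 1 / ((n : ℝ) + 1)) - f x) / (1 / ((n : ℝ) + 1))) atTop
      (𝓝 f') := by
  have h := hasDerivAt_iff_tendsto_slope_zero.1 hx
  have h1 : Tendsto (fun n : ℕ => 1 / ((n : ℝ) + 1)) atTop (𝓝[≠] 0) :=
    tendsto_nhdsWithin_iff.2 ⟨tendsto_one_div_add_atTop_nhds_zero_nat,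
      .of_forall fun n => by simp; positivity⟩
  refine (h.comp h1).congr fun n => ?_
  simp only [Function.comp, smul_eq_mul]
  rw [div_eq_inv_mul (f _ - f x)]

/-- The time slice of `u`, frozen at its initial value for negative times. -/
def slice (u : ℝ → ℝ → ℝ) (s : ℝ) : ℝ → ℝ := fun x => u x (max s 0)

theorem slice_of_nonneg (u : ℝ → ℝ → ℝ) {s : ℝ} (hs : 0 ≤ s) : slice u s = fun x => u x s := by
  ext x; rw [slice, max_eq_left hs]

theorem deriv_slice_of_nonneg (u : ℝ → ℝ → ℝ) {s : ℝ} (hs : 0 ≤ s) (x : ℝ) :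
    deriv (slice u s) x = spatialDeriv u x s := by
  rw [slice_of_nonneg u hs, spatialDeriv]

namespace IsWeakSolution

variable {u : ℝ → ℝ → ℝ} {u₀ : ℝ → ℝ}

theorem slice_zero (hu : IsWeakSolution u u₀) : slice u 0 = u₀ := by
  ext x; rw [slice, max_self, hu.initial]

theorem continuous_slice (hu : IsWeakSolution u u₀) : Continuous (Function.uncurry (slice u)) := by
  have h : Continuous fun p : ℝ × ℝ => ((p.2, max p.1 0) : ℝ × ℝ) := by fun_prop
  exact hu.continuousOn.comp_continuous h fun p => show (0 : ℝ) ≤ max p.1 0 from le_max_right _ _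

theorem absCont_slice (hu : IsWeakSolution u u₀) (s a b : ℝ) :
    AbsolutelyContinuousOnInterval (slice u s) a b :=
  hu.absCont _ (le_max_right _ _) a b

theorem measurable_deriv_slice (hu : IsWeakSolution u u₀) :
    Measurable fun p : ℝ × ℝ => deriv (slice u p.1) p.2 :=
  measurable_deriv_with_param hu.continuous_slice

/-- The energy is bounded at every time, not only at almost every time. -/
theorem exists_energy_bound (hu : IsWeakSolution u u₀) :
    ∃ C : ℝ, ∀ s, Integrable (fun x => deriv (slice u s) x ^ 2) ∧
      ∫ x, deriv (slice u s) x ^ 2 ≤ C := by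
  obtain ⟨C, hC⟩ := hu.deriv_bound
  have hgood : ∀ s, 0 ≤ s → eLpNorm (fun x => spatialDeriv u x s) 2 volume ≤ C →
      ∫⁻ x, ENNReal.ofReal (deriv (slice u s) x ^ 2) ≤ (C : ℝ≥0∞) ^ 2 := by
    intro s hs h
    have h1 := eLpNorm_nnreal_pow_eq_lintegral (μ := volume)
      (f := fun x => spatialDeriv u x s) (p := 2) (by norm_num)
    have h2 : ∫⁻ x, ENNReal.ofReal (deriv (slice u s) x ^ 2)
        = ∫⁻ x, ‖spatialDeriv u x s‖ₑ ^ ((2 : ℝ≥0) : ℝ) := lintegral_congr fun x => by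
      rw [deriv_slice_of_nonneg u hs, ← sq_abs, ENNReal.ofReal_pow (abs_nonneg _),
        ← Real.norm_eq_abs, ofReal_norm]
      simp
    rw [h2, ← h1]
    simpa using ENNReal.pow_le_pow_left (n := 2) h
  have hint : ∀ s, ∫⁻ x, ENNReal.ofReal (deriv (slice u s) x ^ 2) ≤ (C : ℝ≥0∞) ^ 2 →
      Integrable (fun x => deriv (slice u s) x ^ 2) ∧ ∫ x, deriv (slice u s) x ^ 2 ≤ (C : ℝ) ^ 2 := by
    intro s h
    have hm : AEStronglyMeasurable (fun x => deriv (slice u s) x ^ 2) volume :=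
      ((measurable_deriv _).pow_const 2).aestronglyMeasurable
    have hnn : 0 ≤ᵐ[volume] fun x => deriv (slice u s) x ^ 2 := .of_forall fun x => sq_nonneg _
    have htop : (C : ℝ≥0∞) ^ 2 ≠ ⊤ := by simp
    refine ⟨⟨hm, ?_⟩, ?_⟩
    · rw [hasFiniteIntegral_iff_ofReal hnn]
      exact h.trans_lt htop.lt_top
    · rw [integral_eq_lintegral_of_nonneg_ae hnn hm]
      refine (ENNReal.toReal_mono htop h).trans_eq ?_
      simp
  refine ⟨(C : ℝ) ^ 2, fun s => hint s ?_⟩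
  -- Times obeying the energy bound have full measure, so they accumulate from the right at every
  -- time.
  obtain ⟨r, hr0, hrs⟩ : ∃ r : ℕ → ℝ, (∀ n, 0 ≤ r n ∧
      eLpNorm (fun x => spatialDeriv u x (r n)) 2 volume ≤ C) ∧
      Tendsto r atTop (𝓝 (max s 0)) := by
    have hex : ∀ n : ℕ, ∃ r ∈ Ioo (max s 0) (max s 0 + 1 / ((n : ℝ) + 1)),
        eLpNorm (fun x => spatialDeriv u x r) 2 volume ≤ C := by
      intro n
      have hsub : Ioo (max s 0) (max s 0 + 1 / ((n : ℝ) + 1)) ⊆ Ici 0 := fun r hr =>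
        (le_max_right s 0).trans hr.1.le
      have h1 := ae_restrict_of_ae_restrict_of_subset hsub hC
      have h2 := h1.and (ae_restrict_mem measurableSet_Ioo)
      have hne : (ae (volume.restrict (Ioo (max s 0) (max s 0 + 1 / ((n : ℝ) + 1))))).NeBot := by
        rw [ae_restrict_neBot, Real.volume_Ioo]
        simp only [add_sub_cancel_left, ne_eq, ENNReal.ofReal_eq_zero, not_le]
        positivity
      obtain ⟨r, hr⟩ := h2.exists
      exact ⟨r, hr.2, hr.1⟩
    choose r hr1 hr2 using hex
    refine ⟨r, fun n => ⟨(le_max_right s 0).trans (hr1 n).1.le, hr2 n⟩, ?_⟩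
    refine tendsto_of_tendsto_of_tendsto_of_le_of_le tendsto_const_nhds ?_
      (fun n => (hr1 n).1.le) (fun n => (hr1 n).2.le)
    simpa using tendsto_one_div_add_atTop_nhds_zero_nat.const_add (max s 0)
  have hcont : ∀ x, Tendsto (fun n => slice u (r n) x) atTop (𝓝 (slice u s x)) := fun x => by
    have h1 : Continuous fun r => slice u r x :=
      hu.continuous_slice.comp (continuous_id.prodMk continuous_const)
    have h2 : slice u s = slice u (max s 0) := by
      ext x; simp [slice]
    rw [h2]
    exact (h1.tendsto _).comp hrs
  have hsc := fun s => continuous_of_absCont (hu.absCont_slice s)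
  -- Difference quotients of fixed step converge pointwise along `r n` by continuity of `u`, so
  -- Fatou transfers the bound to time `s`. A second use of Fatou, with the step tending to zero,
  -- gives the derivative.
  have hquot : ∀ h > 0, ∫⁻ x, ENNReal.ofReal (((slice u s (x + h) - slice u s x) / h) ^ 2)
      ≤ (C : ℝ≥0∞) ^ 2 := by
    intro h hh
    refine lintegral_ofReal_le_of_tendsto
      (F := fun n x => ((slice u (r n) (x + h) - slice u (r n) x) / h) ^ 2) (fun n => ?_)
      (fun n => ?_) (.of_forall fun x => ?_)
    · have := hsc (r n)
      exact Continuous.measurable (by fun_prop)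
    · have hg := hgood (r n) (hr0 n).1 (hr0 n).2
      refine (lintegral_sq_differenceQuotient_le (hu.absCont_slice _) (hint _ hg).1 hh).trans ?_
      rw [ofReal_integral_eq_lintegral_ofReal (hint _ hg).1 (.of_forall fun x => sq_nonneg _)]
      exact hg
    · exact (((hcont (x + h)).sub (hcont x)).div_const h).pow 2
  refine lintegral_ofReal_le_of_tendsto
    (F := fun n x => ((slice u s (x + 1 / ((n : ℝ) + 1)) - slice u s x) / (1 / ((n : ℝ) + 1))) ^ 2)
    (fun n => ?_) (fun n => hquot _ (by positivity)) ?_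
  · have := hsc s
    exact Continuous.measurable (by fun_prop)
  · filter_upwards [ae_hasDerivAt_of_absCont (hu.absCont_slice s)] with x hx
    exact (tendsto_differenceQuotient hx).pow 2

theorem absCont_integral_mul (hu : IsWeakSolution u u₀) {k : ℝ → ℝ} (hk : Continuous k)
    (hc : HasCompactSupport k) {T : ℝ} (hT : 0 < T) :
    AbsolutelyContinuousOnInterval (fun s => ∫ y, slice u s y * k y) 0 T := by
  obtain ⟨R', hR⟩ := (Metric.isBounded_iff_subset_closedBall 0).1 hc.isCompact.isBounded
  set R := |R'| + 1
  have hRk : ∀ y, y ∉ Icc (-R) R → k y = 0 := fun y hy =>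
    image_eq_zero_of_notMem_tsupport fun h => hy <| by
      have := hR h
      rw [Real.closedBall_eq_Icc] at this
      have h1 := le_abs_self R'
      exact ⟨by linarith [this.1], by linarith [this.2]⟩
  obtain ⟨F, hF, hFac⟩ := hu.absContInTime R (by positivity) T hT
  have hkL : MemLp k 2 (volume.restrict (Icc (-R) R)) :=
    (hk.memLp_of_hasCompactSupport hc).restrict _
  -- The pairing is an inner product with a fixed element of `L²`, hence Lipschitz in the
  -- `L²`-valued curve.
  have hrep : ∀ s ∈ uIcc 0 T, ∫ y, slice u s y * k y = inner ℝ (hkL.toLp k) (F s) := by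
    intro s hs
    rw [uIcc_of_le hT.le] at hs
    rw [L2.inner_def, ← setIntegral_eq_integral_of_forall_compl_eq_zero (s := Icc (-R) R)
      fun y hy => by rw [hRk y hy, mul_zero]]
    refine integral_congr_ae ?_
    filter_upwards [hF s hs, hkL.coeFn_toLp] with y h1 h2
    rw [h1, h2, slice_of_nonneg u hs.1]
    simp
  refine absCont_of_dist_le (c₁ := ‖hkL.toLp k‖) (c₂ := 0) hFac fun r hr s hs => ?_
  rw [hrep r hr, hrep s hs, Real.dist_eq, ← inner_sub_right, zero_mul, add_zero, dist_eq_norm]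
  exact abs_real_inner_le_norm _ _

theorem stronglyMeasurable_integral_mul (hu : IsWeakSolution u u₀) {ψ : ℝ → ℝ}
    (hψ : Continuous ψ) :
    StronglyMeasurable fun s => ∫ y, deriv (slice u s) y ^ 2 * ψ y := by
  have : StronglyMeasurable (Function.uncurry fun (s y : ℝ) => deriv (slice u s) y ^ 2 * ψ y) :=
    ((hu.measurable_deriv_slice.pow_const 2).mul
      (hψ.measurable.comp measurable_snd)).stronglyMeasurable
  exact this.integral_prod_right

theorem stronglyMeasurable_integral_Iic (hu : IsWeakSolution u u₀) :
    StronglyMeasurable fun p : ℝ × ℝ => ∫ y in Iic p.1, deriv (slice u p.2) y ^ 2 := by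
  have hm : Measurable (Function.uncurry fun (p : ℝ × ℝ) (y : ℝ) =>
      indicator {q : (ℝ × ℝ) × ℝ | q.2 ≤ q.1.1} (fun q => deriv (slice u q.1.2) q.2 ^ 2) (p, y)) := by
    refine Measurable.indicator ?_ (measurableSet_le measurable_snd measurable_fst.fst)
    have : Measurable fun q : (ℝ × ℝ) × ℝ => ((q.1.2, q.2) : ℝ × ℝ) := by fun_prop
    exact (hu.measurable_deriv_slice.comp this).pow_const 2
  have h := hm.stronglyMeasurable.integral_prod_right (ν := volume)
  convert h using 2 with p
  rw [← integral_indicator measurableSet_Iic]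
  rfl

/-- The weak formulation for products of a spatial and a temporal test function. -/
theorem integral_time_eq_zero (hu : IsWeakSolution u u₀) {ψ θ : ℝ → ℝ} (hψ : ContDiff ℝ ∞ ψ)
    (hψc : HasCompactSupport ψ) (hθ : ContDiff ℝ ∞ θ) (hθc : HasCompactSupport θ)
    (hθs : tsupport θ ⊆ Ioi 0) :
    ∫ s in Ioi (0 : ℝ), (deriv θ s * (∫ y, slice u s y * deriv ψ y)
      + θ s * ((1 / 2) * (∫ y, slice u s y ^ 2 * deriv (deriv ψ) y)
        - (1 / 2) * ∫ y, deriv (slice u s) y ^ 2 * ψ y)) = 0 := by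
  obtain ⟨C, hC⟩ := hu.exists_energy_bound
  have hψ1 : ContDiff ℝ ∞ (deriv ψ) := (contDiff_infty_iff_deriv.1 hψ).2
  have hψ2 : ContDiff ℝ ∞ (deriv (deriv ψ)) := (contDiff_infty_iff_deriv.1 hψ1).2
  have hθ1 : ContDiff ℝ ∞ (deriv θ) := (contDiff_infty_iff_deriv.1 hθ).2
  have hsc := fun s => continuous_of_absCont (hu.absCont_slice s)
  have hu2 : Continuous fun p : ℝ × ℝ => slice u p.2 p.1 :=
    hu.continuous_slice.comp (continuous_snd.prodMk continuous_fst)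
  -- The spatial factor is `ψ'` rather than `ψ`: this differentiates the equation in `x`, and the
  -- nonlocal term becomes `w²` tested against `ψ`.
  set φ : ℝ × ℝ → ℝ := fun p => deriv ψ p.1 * θ p.2 with hφdef
  have hφ : ContDiff ℝ ∞ φ := (hψ1.comp contDiff_fst).mul (hθ.comp contDiff_snd)
  have hsupp : ∀ a b : ℝ → ℝ, HasCompactSupport a → HasCompactSupport b →
      tsupport (fun p : ℝ × ℝ => a p.1 * b p.2) ⊆ tsupport a ×ˢ tsupport b ∧
      HasCompactSupport (fun p : ℝ × ℝ => a p.1 * b p.2) := by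
    intro a b ha hb
    have h : tsupport (fun p : ℝ × ℝ => a p.1 * b p.2) ⊆ tsupport a ×ˢ tsupport b := by
      refine closure_minimal (fun p hp => ?_) ((isClosed_tsupport a).prod (isClosed_tsupport b))
      exact ⟨subset_tsupport _ (left_ne_zero_of_mul hp),
        subset_tsupport _ (right_ne_zero_of_mul hp)⟩
    exact ⟨h, (ha.isCompact.prod hb.isCompact).of_isClosed_subset (isClosed_tsupport _) h⟩
  have hder : ∀ p : ℝ × ℝ, fderiv ℝ φ p (0, 1) = deriv ψ p.1 * deriv θ p.2 ∧
      fderiv ℝ φ p (1, 0) = deriv (deriv ψ) p.1 * θ p.2 := by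
    intro p
    have h1 : HasFDerivAt (fun q : ℝ × ℝ => deriv ψ q.1)
        (deriv (deriv ψ) p.1 • ContinuousLinearMap.fst ℝ ℝ ℝ) p :=
      ((hψ1.differentiable (by simp)) p.1).hasDerivAt.comp_hasFDerivAt p hasFDerivAt_fst
    have h2 : HasFDerivAt (fun q : ℝ × ℝ => θ q.2)
        (deriv θ p.2 • ContinuousLinearMap.snd ℝ ℝ ℝ) p :=
      ((hθ.differentiable (by simp)) p.2).hasDerivAt.comp_hasFDerivAt p hasFDerivAt_snd
    have h3 : fderiv ℝ φ p = _ := (h1.mul h2).fderiv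
    rw [h3]
    constructor <;> simp [mul_comm]
  have hset : {p : ℝ × ℝ | 0 < p.2} = univ ×ˢ Ioi 0 := by ext p; simp
  have heq := hu.equation φ hφ (hsupp _ _ hψc.deriv hθc).2 fun p hp =>
    hθs ((hsupp _ _ hψc.deriv hθc).1 hp).2
  set E : ℝ × ℝ → ℝ := fun p => slice u p.2 p.1 * (deriv ψ p.1 * deriv θ p.2)
    + (1 / 2) * slice u p.2 p.1 ^ 2 * (deriv (deriv ψ) p.1 * θ p.2)
    + (1 / 2) * (∫ y in Iic p.1, deriv (slice u p.2) y ^ 2) * (deriv ψ p.1 * θ p.2)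
  have hE0 : ∫ p in univ ×ˢ Ioi (0 : ℝ), E p = 0 := by
    rw [← hset]
    refine Eq.trans ?_ heq
    refine setIntegral_congr_fun (measurableSet_lt measurable_const measurable_snd) fun p hp => ?_
    have hp' : 0 ≤ p.2 := le_of_lt hp
    simp only [E, (hder p).1, (hder p).2, slice_of_nonneg u hp']
    rfl
  have hEi : Integrable E := by
    refine (Integrable.add ?_ ?_).add ?_
    · refine Continuous.integrable_of_hasCompactSupport
        (hu2.mul ((hψ1.continuous.comp continuous_fst).mul (hθ1.continuous.comp continuous_snd))) ?_
      exact (hsupp _ _ hψc.deriv hθc.deriv).2.mul_left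
    · refine Continuous.integrable_of_hasCompactSupport ((continuous_const.mul (hu2.pow 2)).mul
        ((hψ2.continuous.comp continuous_fst).mul (hθ.continuous.comp continuous_snd))) ?_
      exact (hsupp _ _ hψc.deriv.deriv hθc).2.mul_left
    · refine Integrable.bdd_mul (c := (1 / 2) * C) ?_ ?_ ?_
      · exact hφ.continuous.integrable_of_hasCompactSupport (hsupp _ _ hψc.deriv hθc).2
      · exact (hu.stronglyMeasurable_integral_Iic.const_mul _).aestronglyMeasurable
      · refine .of_forall fun p => ?_
        have h0 : 0 ≤ ∫ y in Iic p.1, deriv (slice u p.2) y ^ 2 :=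
          integral_nonneg fun _ => sq_nonneg _
        rw [Real.norm_eq_abs, abs_of_nonneg (by positivity)]
        refine mul_le_mul_of_nonneg_left ?_ (by norm_num)
        exact (setIntegral_le_integral (hC p.2).1 (.of_forall fun _ => sq_nonneg _)).trans (hC p.2).2
  rw [Measure.volume_eq_prod, ← Measure.prod_restrict, Measure.restrict_univ,
    integral_prod_symm] at hE0
  swap
  · have := hEi.restrict (s := univ ×ˢ Ioi (0 : ℝ))
    rwa [Measure.volume_eq_prod, ← Measure.prod_restrict, Measure.restrict_univ] at this
  refine Eq.trans ?_ hE0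
  refine integral_congr_ae (.of_forall fun s => ?_)
  beta_reduce
  have i1 : Integrable fun y => deriv θ s * (slice u s y * deriv ψ y) :=
    (((hsc s).mul hψ1.continuous).integrable_of_hasCompactSupport hψc.deriv.mul_left).const_mul _
  have i2 : Integrable fun y => θ s * (1 / 2) * (slice u s y ^ 2 * deriv (deriv ψ) y) :=
    ((((hsc s).pow 2).mul hψ2.continuous).integrable_of_hasCompactSupport
      hψc.deriv.deriv.mul_left).const_mul _
  have i3 : Integrable fun y => θ s * (1 / 2) *
      ((∫ z in Iic y, deriv (slice u s) z ^ 2) * deriv ψ y) := by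
    refine Integrable.const_mul (Integrable.bdd_mul (c := C) ?_ ?_ (.of_forall fun y => ?_)) _
    · exact hψ1.continuous.integrable_of_hasCompactSupport hψc.deriv
    · exact (hu.stronglyMeasurable_integral_Iic.comp_measurable
        (measurable_id.prodMk measurable_const)).aestronglyMeasurable
    · rw [Real.norm_eq_abs, abs_of_nonneg (integral_nonneg fun _ => sq_nonneg _)]
      exact (setIntegral_le_integral (hC s).1 (.of_forall fun _ => sq_nonneg _)).trans (hC s).2
  have hE : ∀ y, E (y, s) = deriv θ s * (slice u s y * deriv ψ y)
      + θ s * (1 / 2) * (slice u s y ^ 2 * deriv (deriv ψ) y)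
      + θ s * (1 / 2) * ((∫ z in Iic y, deriv (slice u s) z ^ 2) * deriv ψ y) := fun y => by
    simp only [E]; ring
  have i4 : Integrable fun y => deriv θ s * (slice u s y * deriv ψ y)
      + θ s * (1 / 2) * (slice u s y ^ 2 * deriv (deriv ψ) y) := i1.add i2
  simp_rw [hE]
  rw [integral_add i4 i3, integral_add i1 i2, integral_const_mul, integral_const_mul,
    integral_const_mul, integral_setIntegral_Iic_mul_deriv (hC s).1
      (hψ.of_le (by exact_mod_cast le_top)) hψc]
  ring

/-- The weak formulation gives the time derivative only as a distribution. Absolute continuity of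
the pairing allows integration by parts against `θ`, and the fundamental lemma of the calculus of
variations identifies the classical derivative almost everywhere. -/
theorem ae_deriv_integral_mul_deriv (hu : IsWeakSolution u u₀) {ψ : ℝ → ℝ} (hψ : ContDiff ℝ ∞ ψ)
    (hψc : HasCompactSupport ψ) {T : ℝ} (hT : 0 < T) :
    ∀ᵐ s, s ∈ Ioo 0 T → deriv (fun s => ∫ y, slice u s y * deriv ψ y) s
      = (1 / 2) * (∫ y, slice u s y ^ 2 * deriv (deriv ψ) y)
        - (1 / 2) * ∫ y, deriv (slice u s) y ^ 2 * ψ y := by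
  obtain ⟨C, hC⟩ := hu.exists_energy_bound
  have hψ1 : ContDiff ℝ ∞ (deriv ψ) := (contDiff_infty_iff_deriv.1 hψ).2
  have hψ2 : ContDiff ℝ ∞ (deriv (deriv ψ)) := (contDiff_infty_iff_deriv.1 hψ1).2
  set A : ℝ → ℝ := fun s => ∫ y, slice u s y * deriv ψ y
  set B : ℝ → ℝ := fun s => (1 / 2) * (∫ y, slice u s y ^ 2 * deriv (deriv ψ) y)
        - (1 / 2) * ∫ y, deriv (slice u s) y ^ 2 * ψ y
  have hA : AbsolutelyContinuousOnInterval A 0 T :=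
    hu.absCont_integral_mul hψ1.continuous hψc.deriv hT
  have hAi := hA.intervalIntegrable_deriv
  have hB1 : Continuous fun s => ∫ y, slice u s y ^ 2 * deriv (deriv ψ) y := by
    have := continuous_parametric_integral_of_continuous (μ := volume)
      (f := fun s y => slice u s y ^ 2 * deriv (deriv ψ) y)
      (show Continuous fun p : ℝ × ℝ => slice u p.1 p.2 ^ 2 * deriv (deriv ψ) p.2 from
        (hu.continuous_slice.pow 2).mul (hψ2.continuous.comp continuous_snd)) hψc.deriv.deriv.isCompact
    refine this.congr fun s => setIntegral_eq_integral_of_forall_compl_eq_zero fun y hy => ?_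
    rw [image_eq_zero_of_notMem_tsupport hy, mul_zero]
  obtain ⟨M, hM⟩ := hψc.exists_bound_of_continuous hψ.continuous
  have hB2 : IntervalIntegrable (fun s => ∫ y, deriv (slice u s) y ^ 2 * ψ y) volume 0 T := by
    rw [intervalIntegrable_iff_integrableOn_Ioc_of_le hT.le]
    refine Measure.integrableOn_of_bounded (M := C * M) (by simp)
      (hu.stronglyMeasurable_integral_mul hψ.continuous).aestronglyMeasurable
      (.of_forall fun s => ?_)
    have hM0 : 0 ≤ M := (norm_nonneg _).trans (hM 0)
    calc ‖∫ y, deriv (slice u s) y ^ 2 * ψ y‖ ≤ ∫ y, deriv (slice u s) y ^ 2 * M := by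
          refine norm_integral_le_of_norm_le ((hC s).1.mul_const M) (.of_forall fun y => ?_)
          rw [norm_mul, Real.norm_eq_abs, abs_of_nonneg (sq_nonneg _)]
          exact mul_le_mul_of_nonneg_left (hM y) (sq_nonneg _)
      _ ≤ C * M := by
          rw [integral_mul_const]
          exact mul_le_mul_of_nonneg_right (hC s).2 hM0
  have hBi : IntervalIntegrable B volume 0 T :=
    ((hB1.intervalIntegrable 0 T).const_mul _).sub (hB2.const_mul _)
  have key := isOpen_Ioo.ae_eq_zero_of_integral_contDiff_smul_eq_zero (U := Ioo 0 T)
    (μ := volume) (f := fun s => deriv A s - B s) ?_ fun θ hθ hθc hθs => ?_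
  · filter_upwards [key] with s hs h
    exact sub_eq_zero.1 (hs h)
  · have := (hAi.sub hBi).1
    exact (this.mono_set Ioo_subset_Ioc_self).locallyIntegrableOn
  · have hout : ∀ s, s ∉ Ioo 0 T → θ s = 0 := fun s hs =>
      image_eq_zero_of_notMem_tsupport fun h => hs (hθs h)
    have hout' : ∀ s, s ∉ Ioo 0 T → deriv θ s = 0 := fun s hs => by
      by_contra h
      exact hs (hθs (support_deriv_subset (Function.mem_support.2 h)))
    have hθ1 : ContDiff ℝ ∞ (deriv θ) := (contDiff_infty_iff_deriv.1 hθ).2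
    have h0 := hu.integral_time_eq_zero hψ hψc hθ hθc (hθs.trans Ioo_subset_Ioi_self)
    have h0' : ∫ s in (0 : ℝ)..T, (deriv θ s * A s + θ s * B s) = 0 := by
      rw [intervalIntegral.integral_of_le hT.le]
      refine Eq.trans ?_ h0
      refine (setIntegral_eq_of_subset_of_forall_sdiff_eq_zero measurableSet_Ioi
        Ioc_subset_Ioi_self fun s hs => ?_).symm
      have hs' : s ∉ Ioo 0 T := fun h => hs.2 ⟨h.1, h.2.le⟩
      simp only [hout s hs', hout' s hs', zero_mul, add_zero]
    have hθac : AbsolutelyContinuousOnInterval θ 0 T :=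
      (hθ.of_le (by exact_mod_cast le_top)).contDiffOn.absolutelyContinuousOnInterval
    have hparts := hθac.integral_mul_deriv_eq_deriv_mul hA
    rw [hout T (by simp), hout 0 (by simp), zero_mul, zero_mul, sub_zero, zero_sub] at hparts
    have i1 : IntervalIntegrable (fun s => deriv θ s * A s) volume 0 T := by
      refine ContinuousOn.intervalIntegrable ?_
      exact hθ1.continuous.continuousOn.mul hA.continuousOn
    have i2 : IntervalIntegrable (fun s => θ s * B s) volume 0 T :=
      hBi.continuousOn_mul hθ.continuous.continuousOn
    have i3 : IntervalIntegrable (fun s => θ s * deriv A s) volume 0 T :=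
      hAi.continuousOn_mul hθ.continuous.continuousOn
    rw [intervalIntegral.integral_add i1 i2] at h0'
    have h1 : ∫ s in (0 : ℝ)..T, θ s • (deriv A s - B s) = 0 := by
      simp_rw [smul_eq_mul, mul_sub]
      rw [intervalIntegral.integral_sub i3 i2]
      linarith
    rw [← h1]
    refine (intervalIntegral.integral_eq_integral_of_support_subset fun s hs => ?_).symm
    by_contra h
    exact hs (by simp [hout s fun h' => h (Ioo_subset_Ioc_self h')])

/-- The evolution of the mollified spatial derivative. -/
theorem ae_deriv_mollify (hu : IsWeakSolution u u₀) {κ : ℝ → ℝ} {ε c : ℝ}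
    (hκ : IsMollifier κ ε c) (x : ℝ) {T : ℝ} (hT : 0 < T) :
    AbsolutelyContinuousOnInterval (fun s => mollify (deriv κ) (slice u s) x) 0 T ∧
    ∀ᵐ s, s ∈ Ioo 0 T → deriv (fun s => mollify (deriv κ) (slice u s) x) s
      = mollifiedForcing κ (slice u s) x := by
  -- The test function is the reflected kernel centred at `x`. Reflection flips the sign of the
  -- first derivative but not of the second.
  have hψ : ContDiff ℝ ∞ fun y => κ (x - y) := hκ.contDiff.comp (contDiff_const.sub contDiff_id)
  have hψc : HasCompactSupport fun y => κ (x - y) :=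
    hκ.hasCompactSupport.comp_homeomorph (Homeomorph.subLeft x)
  have hd1 : deriv (fun y => κ (x - y)) = fun y => -deriv κ (x - y) :=
    funext fun y => deriv_comp_const_sub _ _ _
  have hd2 : deriv (deriv (fun y => κ (x - y))) = fun y => deriv (deriv κ) (x - y) := by
    rw [hd1]
    ext y
    rw [deriv.fun_neg, deriv_comp_const_sub, neg_neg]
  have hA : (fun s => mollify (deriv κ) (slice u s) x)
      = fun s => -∫ y, slice u s y * deriv (fun y => κ (x - y)) y := by
    ext s
    rw [mollify_eq_integral_mul_sub, hd1, ← integral_neg]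
    simp
  constructor
  · rw [hA]
    refine (hu.absCont_integral_mul ?_ hψc.deriv hT).fun_neg
    exact (contDiff_infty_iff_deriv.1 hψ).2.continuous
  · filter_upwards [hu.ae_deriv_integral_mul_deriv hψ hψc hT] with s hs h
    rw [hA, deriv.fun_neg, hs h, hd2, mollifiedForcing, mollify_eq_integral_mul_sub,
      mollify_eq_integral_mul_sub]
    ring

end IsWeakSolution

/-! ### Entropy balance and removal of mollifier and cutoff -/

theorem continuous_mollify_family {k : ℝ → ℝ} (hk : Continuous k) (hc : HasCompactSupport k)
    {h : ℝ → ℝ → ℝ} (hh : Continuous (Function.uncurry h)) :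
    Continuous fun p : ℝ × ℝ => mollify k (h p.2) p.1 := by
  have hh' : Continuous fun q : (ℝ × ℝ) × ℝ => h q.1.2 (q.1.1 - q.2) * k q.2 := by
    have h1 : Continuous fun q : (ℝ × ℝ) × ℝ => ((q.1.2, q.1.1 - q.2) : ℝ × ℝ) := by fun_prop
    exact (hh.comp h1).mul (hk.comp continuous_snd)
  have := continuous_parametric_integral_of_continuous (μ := volume)
    (f := fun (p : ℝ × ℝ) y => h p.2 (p.1 - y) * k y) hh' hc.isCompact
  refine this.congr fun p => setIntegral_eq_integral_of_forall_compl_eq_zero fun y hy => ?_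
  rw [image_eq_zero_of_notMem_tsupport hy, mul_zero]

namespace IsMollifier

variable {κ : ℝ → ℝ} {ε c : ℝ}

theorem mollify_le_integral (hκ : IsMollifier κ ε c) {g : ℝ → ℝ} (hg : ∀ x, 0 ≤ g x)
    (hgi : Integrable g) (x : ℝ) : mollify κ g x ≤ c / ε * ∫ y, g y := by
  have hi : Integrable fun y => g (x - y) * (c / ε) := (hgi.comp_sub_left x).mul_const _
  rw [mul_comm, ← integral_sub_left_eq_self g volume x, ← integral_mul_const, mollify]
  refine integral_mono_of_nonneg (.of_forall fun y => mul_nonneg (hg _) (hκ.nonneg y)) hi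
    (.of_forall fun y => mul_le_mul_of_nonneg_left ((le_abs_self _).trans (hκ.bound y)) (hg _))

end IsMollifier

/-- The density is `K`-Lipschitz in `w`, and in `s` it has Lipschitz constant `K sup |W|` along the
curve. The fundamental theorem of calculus thus holds for `β(s, W(s))`. -/
theorem IsEntropyDensity.absCont_comp {T K : ℝ} {β βs βw : ℝ → ℝ → ℝ}
    (hβ : IsEntropyDensity T K β βs βw) (hT : 0 < T) {W : ℝ → ℝ}
    (hW : AbsolutelyContinuousOnInterval W 0 T) :
    AbsolutelyContinuousOnInterval (fun s => β s (W s)) 0 T := by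
  obtain ⟨M, hM⟩ := hW.exists_bound
  rw [uIcc_of_le hT.le] at hM
  have hK : 0 ≤ K := (abs_nonneg _).trans (hβ.abs_right_le 0 ⟨le_rfl, hT.le⟩ 0)
  refine absCont_of_dist_le (c₁ := K) (c₂ := K * M) hW fun r hr s hs => ?_
  rw [uIcc_of_le hT.le] at hr hs
  refine (dist_triangle _ (β r (W s)) _).trans (add_le_add ?_ ?_)
  · have := (hβ.lipschitzWith_right hr).dist_le_mul (W r) (W s)
    rwa [Real.coe_toNNReal K hK] at this
  · have hd : ∀ z ∈ Icc 0 T, HasDerivWithinAt (fun z => β z (W s)) (βs z (W s)) (Icc 0 T) z :=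
      fun z hz => by
        have := hβ.hasDerivAt_comp z hz (fun _ => W s) 0 (hasDerivAt_const z (W s))
        rw [mul_zero, add_zero] at this
        exact this.hasDerivWithinAt
    have := (convex_Icc 0 T).norm_image_sub_le_of_norm_hasDerivWithin_le (C := K * M) hd
      (fun z hz => (hβ.abs_left_le z hz _).trans (mul_le_mul_of_nonneg_left (hM s hs) hK)) hs hr
    rwa [Real.dist_eq, Real.dist_eq]

namespace IsWeakSolution

variable {u : ℝ → ℝ → ℝ} {u₀ : ℝ → ℝ} {T K c C D : ℝ} {β βs βw : ℝ → ℝ → ℝ} {χ : ℝ → ℝ}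

theorem measurable_mollifiedForcing (hu : IsWeakSolution u u₀) {κ : ℝ → ℝ} {ε : ℝ}
    (hκ : IsMollifier κ ε c) :
    Measurable fun p : ℝ × ℝ => mollifiedForcing κ (slice u p.2) p.1 := by
  have h1 : Continuous fun p : ℝ × ℝ =>
      mollify (deriv (deriv κ)) (fun y => slice u p.2 y ^ 2) p.1 :=
    continuous_mollify_family hκ.contDiff_deriv_deriv.continuous hκ.hasCompactSupport.deriv.deriv
      (h := fun s y => slice u s y ^ 2) (hu.continuous_slice.pow 2)
  have h2 : StronglyMeasurable fun p : ℝ × ℝ =>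
      ∫ y, deriv (slice u p.2) (p.1 - y) ^ 2 * κ y := by
    have hm : Measurable (Function.uncurry fun (p : ℝ × ℝ) (y : ℝ) =>
        deriv (slice u p.2) (p.1 - y) ^ 2 * κ y) := by
      have h3 : Measurable fun q : (ℝ × ℝ) × ℝ => ((q.1.2, q.1.1 - q.2) : ℝ × ℝ) := by fun_prop
      exact ((hu.measurable_deriv_slice.comp h3).pow_const 2).mul
        (hκ.contDiff.continuous.measurable.comp measurable_snd)
    exact hm.stronglyMeasurable.integral_prod_right
  exact ((h1.measurable.const_mul _).neg).add (h2.measurable.const_mul _)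

/-- The entropy balance for the mollified solution. -/
theorem integral_entropy_eq (hu : IsWeakSolution u u₀) (hT : 0 < T)
    (hC : ∀ s, Integrable (fun x => deriv (slice u s) x ^ 2) ∧
      ∫ x, deriv (slice u s) x ^ 2 ≤ C)
    (hβ : IsEntropyDensity T K β βs βw) (hχ : ContDiff ℝ 1 χ) (hχc : HasCompactSupport χ)
    {κ : ℝ → ℝ} {ε : ℝ} (hκ : IsMollifier κ ε c) :
    IntegrableOn (fun s => ∫ x, χ x * (βs s (mollify (deriv κ) (slice u s) x)
      + βw s (mollify (deriv κ) (slice u s) x) * mollifiedForcing κ (slice u s) x)) (Ioc 0 T) ∧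
    ∫ x, χ x * (β T (mollify (deriv κ) (slice u T) x) - β 0 (mollify (deriv κ) (slice u 0) x))
      = ∫ s in Ioc 0 T, ∫ x, χ x * (βs s (mollify (deriv κ) (slice u s) x)
        + βw s (mollify (deriv κ) (slice u s) x) * mollifiedForcing κ (slice u s) x) := by
  have hK : 0 ≤ K := (abs_nonneg _).trans (hβ.abs_right_le 0 ⟨le_rfl, hT.le⟩ 0)
  have hcε : 0 ≤ c / ε := (abs_nonneg _).trans (hκ.bound 0)
  have hWc : Continuous fun p : ℝ × ℝ => mollify (deriv κ) (slice u p.2) p.1 :=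
    continuous_mollify_family hκ.contDiff_deriv.continuous hκ.hasCompactSupport.deriv
      hu.continuous_slice
  have hmc : Continuous fun p : ℝ × ℝ =>
      mollify (deriv (deriv κ)) (fun y => slice u p.2 y ^ 2) p.1 :=
    continuous_mollify_family hκ.contDiff_deriv_deriv.continuous hκ.hasCompactSupport.deriv.deriv
      (h := fun s y => slice u s y ^ 2) (hu.continuous_slice.pow 2)
  set H : ℝ → ℝ → ℝ := fun x s => βs s (mollify (deriv κ) (slice u s) x)
      + βw s (mollify (deriv κ) (slice u s) x) * mollifiedForcing κ (slice u s) x with hH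
  have hHm : Measurable fun p : ℝ × ℝ => χ p.1 * H p.1 p.2 := by
    have e : Measurable fun p : ℝ × ℝ => (p.2, mollify (deriv κ) (slice u p.2) p.1) :=
      measurable_snd.prodMk hWc.measurable
    exact (hχ.continuous.measurable.comp measurable_fst).mul ((hβ.measurable_left.comp e).add
      ((hβ.measurable_right.comp e).mul (hu.measurable_mollifiedForcing hκ)))
  -- A bound uniform in time on the support of `χ`, needed for Fubini.
  obtain ⟨M, hM⟩ : ∃ M, ∀ x s, s ∈ Icc 0 T → |χ x * H x s| ≤ |χ x| * M := by
    have hbc : Continuous fun p : ℝ × ℝ => K * |mollify (deriv κ) (slice u p.2) p.1|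
        + K * ((1 / 2) * |mollify (deriv (deriv κ)) (fun y => slice u p.2 y ^ 2) p.1|
          + (1 / 2) * (c / ε * C)) := by fun_prop
    obtain ⟨M, hM⟩ := (hχc.isCompact.prod (isCompact_Icc (a := (0 : ℝ)) (b := T))).bddAbove_image
      hbc.continuousOn
    refine ⟨M, fun x s hs => ?_⟩
    by_cases hx : x ∈ tsupport χ
    · rw [abs_mul]
      refine mul_le_mul_of_nonneg_left (le_trans ?_ (hM ⟨(x, s), ⟨hx, hs⟩, rfl⟩)) (abs_nonneg _)
      refine (abs_add_le _ _).trans (add_le_add (hβ.abs_left_le s hs _) ?_)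
      rw [abs_mul]
      refine mul_le_mul (hβ.abs_right_le s hs _) ?_ (abs_nonneg _) hK
      rw [mollifiedForcing]
      have h0 := hκ.mollify_nonneg (g := fun y => deriv (slice u s) y ^ 2)
        (fun _ => sq_nonneg _) x
      refine (abs_add_le _ _).trans (add_le_add (by rw [abs_neg, abs_mul]; norm_num) ?_)
      rw [abs_of_nonneg (by positivity)]
      refine mul_le_mul_of_nonneg_left ?_ (by norm_num)
      exact (hκ.mollify_le_integral (fun _ => sq_nonneg _) (hC s).1 x).trans
        (mul_le_mul_of_nonneg_left (hC s).2 hcε)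
    · rw [image_eq_zero_of_notMem_tsupport hx]; simp
  have hHi : Integrable (fun p : ℝ × ℝ => χ p.1 * H p.1 p.2)
      (volume.prod (volume.restrict (Ioc 0 T))) := by
    have hχi := (hχ.continuous.integrable_of_hasCompactSupport hχc (μ := volume)).abs
    have hb : Integrable (fun p : ℝ × ℝ => |χ p.1| * M) (volume.prod (volume.restrict (Ioc 0 T))) :=
      hχi.mul_prod (integrable_const M)
    refine hb.mono' hHm.aestronglyMeasurable ?_
    have hr : (volume : Measure ℝ).prod (volume.restrict (Ioc 0 T))
        = (volume.prod volume).restrict (univ ×ˢ Ioc 0 T) := by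
      rw [← Measure.prod_restrict, Measure.restrict_univ]
    rw [hr]
    filter_upwards [ae_restrict_mem (MeasurableSet.univ.prod measurableSet_Ioc)] with p hp
    exact hM p.1 p.2 (Ioc_subset_Icc_self hp.2)
  have hx : ∀ x, χ x * (β T (mollify (deriv κ) (slice u T) x)
      - β 0 (mollify (deriv κ) (slice u 0) x)) = ∫ s in Ioc 0 T, χ x * H x s := by
    intro x
    obtain ⟨hWac, hWd⟩ := hu.ae_deriv_mollify hκ x hT
    rw [integral_const_mul, ← intervalIntegral.integral_of_le hT.le]
    congr 1
    rw [← (hβ.absCont_comp hT hWac).integral_deriv_eq_sub]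
    refine intervalIntegral.integral_congr_ae ?_
    -- The evolution equation is available only on the open interval, so the endpoint is discarded.
    have hne : ∀ᵐ s : ℝ, s ≠ T := by simp [ae_iff, measure_singleton]
    filter_upwards [hWac.ae_differentiableAt, hWd, hne] with s h1 h2 h3 h4
    rw [uIoc_of_le hT.le] at h4
    have h5 : s ∈ Ioo 0 T := ⟨h4.1, lt_of_le_of_ne h4.2 h3⟩
    have h6 := (h1 (by rw [uIcc_of_le hT.le]; exact Ioc_subset_Icc_self h4)).hasDerivAt
    rw [h2 h5] at h6
    exact (hβ.hasDerivAt_comp s (Ioo_subset_Icc_self h5) _ _ h6).deriv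
  refine ⟨hHi.swap.integral_prod_left, ?_⟩
  rw [integral_congr_ae (.of_forall hx)]
  exact integral_integral_swap hHi

/-- The mollification parameter tends to zero with the cutoff fixed. The loss that remains is `D`
times the bound `8c²C` on `∫ W²`, integrated over `[0, T]`. -/
theorem integral_cutoff_entropy_ge (hu : IsWeakSolution u u₀) (hT : 0 < T)
    (hC : ∀ s, Integrable (fun x => deriv (slice u s) x ^ 2) ∧
      ∫ x, deriv (slice u s) x ^ 2 ≤ C)
    (hc0 : 0 ≤ c) (hc : ∀ ε > 0, ∃ κ, IsMollifier κ ε c)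
    (hβ : IsEntropyDensity T K β βs βw) (hχ : ContDiff ℝ 1 χ) (hχc : HasCompactSupport χ)
    (hχ0 : ∀ x, 0 ≤ χ x) (hχ1 : ∀ x, χ x ≤ 1)
    (hD : ∀ s ∈ Icc 0 T, ∀ x, |deriv χ x * slice u s x| ≤ D) :
    -(D * (8 * c ^ 2 * C) * T)
      ≤ ∫ x, χ x * (β T (deriv (slice u T) x) - β 0 (deriv (slice u 0) x)) := by
  have h0T : (0 : ℝ) ∈ Icc 0 T := ⟨le_rfl, hT.le⟩
  have hTT : T ∈ Icc 0 T := ⟨hT.le, le_rfl⟩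
  have hK : 0 ≤ K := (abs_nonneg _).trans (hβ.abs_right_le 0 h0T 0)
  have hD0 : 0 ≤ D := (abs_nonneg _).trans (hD 0 h0T 0)
  set ε : ℕ → ℝ := fun n => 1 / ((n : ℝ) + 1)
  have hε : ∀ n, 0 < ε n := fun n => by positivity
  have hε0 : Tendsto ε atTop (𝓝 0) := tendsto_one_div_add_atTop_nhds_zero_nat
  choose κ hκ using fun n => hc (ε n) (hε n)
  set J : ℕ → ℝ → ℝ := fun n s => ∫ x, χ x * (βs s (mollify (deriv (κ n)) (slice u s) x)
      + βw s (mollify (deriv (κ n)) (slice u s) x) * mollifiedForcing (κ n) (slice u s) x)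
  set D' := D * (8 * c ^ 2 * C)
  have hJi : ∀ n, IntegrableOn (J n) (Ioc 0 T) := fun n =>
    (hu.integral_entropy_eq hT hC hβ hχ hχc (hκ n)).1
  have hJge : ∀ n, ∀ s ∈ Icc 0 T,
      -(K * ∫ x, mollifyError (κ n) (slice u s) x) ≤ J n s + D' := fun n s hs => by
    have h1 := hβ.integral_forcing_ge hs (hκ n) (hε n) (hu.absCont_slice s) (hC s).1 hχ hχc hχ0 hχ1
      (hD s hs)
    have h2 := (integral_sq_mollify_deriv_le (hκ n) (hε n) (hu.absCont_slice s) (hC s).1).2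
    have h3 : D * ∫ x, mollify (deriv (κ n)) (slice u s) x ^ 2 ≤ D' :=
      mul_le_mul_of_nonneg_left
        (h2.trans (mul_le_mul_of_nonneg_left (hC s).2 (by positivity))) hD0
    simp only [J]
    linarith
  -- The production is controlled uniformly in `n` only from below. Its negative part is dominated
  -- in time by a constant and tends to zero at each time.
  have hj : Tendsto (fun n => ∫ s in Ioc 0 T, min (J n s + D') 0) atTop (𝓝 0) := by
    have hconst : Integrable (fun _ : ℝ => K * ((16 * c ^ 2 + 4 * c + 1) * C))
        (volume.restrict (Ioc 0 T)) := integrable_const _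
    have := tendsto_integral_of_dominated_convergence (f := fun _ => (0 : ℝ))
      (F := fun n s => min (J n s + D') 0) (μ := volume.restrict (Ioc 0 T)) _ (fun n => ?_)
      hconst (fun n => ?_) ?_
    · simpa using this
    · exact ((hJi n).add (integrable_const D')).aestronglyMeasurable.inf
        aestronglyMeasurable_const
    · filter_upwards [ae_restrict_mem measurableSet_Ioc] with s hs
      have h1 := hJge n s (Ioc_subset_Icc_self hs)
      have h2 := (integral_mollifyError_le (hκ n) (hε n) (hu.absCont_slice s) (hC s).1).trans
        (mul_le_mul_of_nonneg_left (hC s).2 (by positivity))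
      have h3 := mul_le_mul_of_nonneg_left h2 hK
      have h4 : 0 ≤ K * ∫ x, mollifyError (κ n) (slice u s) x :=
        mul_nonneg hK (integral_nonneg fun _ => mollifyError_nonneg _ _ _)
      rw [Real.norm_eq_abs, abs_of_nonpos (min_le_right _ _), neg_le]
      exact le_min (by linarith) (by linarith)
    · filter_upwards [ae_restrict_mem measurableSet_Ioc] with s hs
      have h1 := (tendsto_integral_mollifyError (hu.absCont_slice s) (hC s).1 hκ hε hε0 hc0).const_mul
        K |>.neg
      rw [mul_zero, neg_zero] at h1
      refine tendsto_of_tendsto_of_tendsto_of_le_of_le h1 tendsto_const_nhds (fun n => ?_)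
        (fun n => min_le_right _ _)
      refine le_min (hJge n s (Ioc_subset_Icc_self hs)) (neg_nonpos.2 ?_)
      exact mul_nonneg hK (integral_nonneg fun _ => mollifyError_nonneg _ _ _)
  have hL : Tendsto (fun n => ∫ x, χ x * (β T (mollify (deriv (κ n)) (slice u T) x)
      - β 0 (mollify (deriv (κ n)) (slice u 0) x))) atTop
      (𝓝 (∫ x, χ x * (β T (deriv (slice u T) x) - β 0 (deriv (slice u 0) x)))) := by
    refine tendsto_integral_of_dominated_convergence (fun x => χ x * K) (fun n => ?_)
      ((hχ.continuous.integrable_of_hasCompactSupport hχc).mul_const K) (fun n => ?_) ?_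
    · have hW := fun s => (hκ n).continuous_mollify_deriv
        (continuous_of_absCont (hu.absCont_slice s))
      exact (hχ.continuous.mul (((hβ.continuous_right hTT).comp (hW T)).sub
        ((hβ.continuous_right h0T).comp (hW 0)))).aestronglyMeasurable
    · refine .of_forall fun x => ?_
      rw [Real.norm_eq_abs, abs_mul, abs_of_nonneg (hχ0 x)]
      refine mul_le_mul_of_nonneg_left (abs_le.2 ⟨?_, ?_⟩) (hχ0 x)
      · linarith [hβ.nonneg T hTT (mollify (deriv (κ n)) (slice u T) x),
          hβ.le_const 0 h0T (mollify (deriv (κ n)) (slice u 0) x)]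
      · linarith [hβ.nonneg 0 h0T (mollify (deriv (κ n)) (slice u 0) x),
          hβ.le_const T hTT (mollify (deriv (κ n)) (slice u T) x)]
    · filter_upwards [ae_hasDerivAt_of_absCont (hu.absCont_slice T),
        ae_hasDerivAt_of_absCont (hu.absCont_slice 0)] with x h1 h2
      have hsc := fun s => continuous_of_absCont (hu.absCont_slice s)
      exact ((((hβ.continuous_right hTT).tendsto _).comp
        (tendsto_mollify_deriv (hsc T) hκ hε hε0 h1)).sub
        (((hβ.continuous_right h0T).tendsto _).comp
        (tendsto_mollify_deriv (hsc 0) hκ hε hε0 h2))).const_mul _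
  have hlim := hj.sub_const (D' * T)
  rw [zero_sub] at hlim
  refine le_of_tendsto_of_tendsto' hlim hL fun n => ?_
  rw [(hu.integral_entropy_eq hT hC hβ hχ hχc (hκ n)).2]
  have hJD : IntegrableOn (fun s => J n s + D') (Ioc 0 T) := (hJi n).add (integrable_const D')
  have h1 : ∫ s in Ioc 0 T, min (J n s + D') 0 ≤ ∫ s in Ioc 0 T, (J n s + D') :=
    integral_mono (hJD.inf (integrable_const 0)) hJD fun s => min_le_left _ _
  have h2 : ∫ s in Ioc 0 T, (J n s + D') = (∫ s in Ioc 0 T, J n s) + D' * T := by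
    rw [integral_add (hJi n) (integrable_const D')]
    simp [hT.le, mul_comm]
  linarith

/-- By Cauchy-Schwarz `u` grows at most like `√|x|`, slower than the reciprocal of the derivative of
a cutoff at scale `|x|`. -/
theorem abs_slice_le (hu : IsWeakSolution u u₀)
    (hC : ∀ s, Integrable (fun x => deriv (slice u s) x ^ 2) ∧
      ∫ x, deriv (slice u s) x ^ 2 ≤ C) (s x : ℝ) :
    |slice u s x| ≤ |slice u s 0| + √(|x| * C) := by
  have key : ∀ a b, a ≤ b → (slice u s b - slice u s a) ^ 2 ≤ (b - a) * C := fun a b hab => by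
    refine (sq_sub_le_mul_integral_sq (hu.absCont_slice s) (hC s).1 hab).trans
      (mul_le_mul_of_nonneg_left ?_ (by linarith))
    rw [intervalIntegral.integral_of_le hab]
    exact (setIntegral_le_integral (hC s).1 (.of_forall fun _ => sq_nonneg _)).trans (hC s).2
  have h : (slice u s x - slice u s 0) ^ 2 ≤ |x| * C := by
    rcases le_total 0 x with hx | hx
    · simpa [abs_of_nonneg hx] using key 0 x hx
    · have := key x 0 hx
      rw [abs_of_nonpos hx]
      linarith [show (slice u s 0 - slice u s x) ^ 2 = (slice u s x - slice u s 0) ^ 2 by ring]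
  have h2 := Real.abs_le_sqrt h
  have h3 := abs_add_le (slice u s x - slice u s 0) (slice u s 0)
  rw [sub_add_cancel] at h3
  linarith

/-- Smooth cutoffs at scale `n + 1` whose derivatives are negligible against the solution. -/
theorem exists_cutoff (hu : IsWeakSolution u u₀)
    (hC : ∀ s, Integrable (fun x => deriv (slice u s) x ^ 2) ∧
      ∫ x, deriv (slice u s) x ^ 2 ≤ C) :
    ∃ (χ : ℕ → ℝ → ℝ) (D : ℕ → ℝ), (∀ n, ContDiff ℝ 1 (χ n)) ∧ (∀ n, HasCompactSupport (χ n)) ∧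
      (∀ n x, 0 ≤ χ n x) ∧ (∀ n x, χ n x ≤ 1) ∧
      (∀ n, ∀ s ∈ Icc 0 T, ∀ x, |deriv (χ n) x * slice u s x| ≤ D n) ∧
      (∀ x, Tendsto (fun n => χ n x) atTop (𝓝 1)) ∧ Tendsto D atTop (𝓝 0) := by
  have hC0 : 0 ≤ C := (integral_nonneg fun _ => sq_nonneg _).trans (hC 0).2
  let b : ContDiffBump (0 : ℝ) := ⟨1, 2, one_pos, one_lt_two⟩
  have hb1 : ContDiff ℝ 1 b := b.contDiff
  obtain ⟨c, hc⟩ := b.hasCompactSupport.deriv.exists_bound_of_continuous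
    (hb1.continuous_deriv le_rfl)
  have hc0 : 0 ≤ c := (norm_nonneg _).trans (hc 0)
  obtain ⟨U, hU⟩ : ∃ U, ∀ s ∈ Icc 0 T, |slice u s 0| ≤ U := by
    have h1 : Continuous fun s => |slice u s 0| :=
      (hu.continuous_slice.comp (continuous_id.prodMk continuous_const)).abs
    obtain ⟨U, hU⟩ := isCompact_Icc.bddAbove_image (h1.continuousOn (s := Icc 0 T))
    exact ⟨U, fun s hs => hU ⟨s, hs, rfl⟩⟩
  set r : ℕ → ℝ := fun n => 1 / ((n : ℝ) + 1) with hr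
  have hrpos : ∀ n, 0 < r n := fun n => by positivity
  have hr0 : Tendsto r atTop (𝓝 0) := tendsto_one_div_add_atTop_nhds_zero_nat
  have hd : ∀ n x, deriv (fun x => b (r n * x)) x = r n * deriv b (r n * x) := fun n x => by
    rw [deriv_comp_mul_left, smul_eq_mul]
  -- On the support `r n * |x| ≤ 2`, so `r n * √(|x| * C) ≤ √(2 * C * r n)`; this gives the second
  -- term of `D n`.
  refine ⟨fun n x => b (r n * x), fun n => r n * c * |U| + c * √(2 * C * r n), fun n => ?_,
    fun n => ?_, fun n x => b.nonneg, fun n x => b.le_one, fun n s hs x => ?_, fun x => ?_, ?_⟩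
  · exact hb1.comp (contDiff_const.mul contDiff_id)
  · exact b.hasCompactSupport.comp_homeomorph (Homeomorph.mulLeft₀ (r n) (hrpos n).ne')
  · rw [hd]
    by_cases hx : r n * x ∈ tsupport b
    · rw [b.tsupport_eq, Real.closedBall_eq_Icc] at hx
      have hx' : |r n * x| ≤ 2 := abs_le.2 (by simpa [b] using hx)
      rw [abs_mul, abs_of_pos (hrpos n)] at hx'
      have h1 := hu.abs_slice_le hC s x
      have h2 : |slice u s 0| ≤ |U| := (hU s hs).trans (le_abs_self U)
      have h3 : r n * √(|x| * C) ≤ √(2 * C * r n) := by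
        refine Real.le_sqrt_of_sq_le ?_
        rw [mul_pow, Real.sq_sqrt (by positivity)]
        have := mul_le_mul_of_nonneg_right hx' (mul_nonneg hC0 (hrpos n).le)
        nlinarith
      have h4 := hc (r n * x)
      rw [Real.norm_eq_abs] at h4
      rw [abs_mul, abs_mul, abs_of_pos (hrpos n)]
      calc r n * |deriv b (r n * x)| * |slice u s x|
          ≤ r n * c * (|U| + √(|x| * C)) := by
            have := hrpos n
            gcongr
            linarith
        _ = r n * c * |U| + c * (r n * √(|x| * C)) := by ring
        _ ≤ _ := add_le_add le_rfl (mul_le_mul_of_nonneg_left h3 hc0)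
    · have : deriv b (r n * x) = 0 := by
        by_contra h
        exact hx (support_deriv_subset (Function.mem_support.2 h))
      rw [this, mul_zero, zero_mul, abs_zero]
      have := hrpos n
      positivity
  · have h1 : Tendsto (fun n => r n * x) atTop (𝓝 0) := by simpa using hr0.mul_const x
    have h2 := (b.continuous.tendsto 0).comp h1
    rwa [b.one_of_mem_closedBall (by simp [b])] at h2
  · have h1 : Tendsto (fun n => √(2 * C * r n)) atTop (𝓝 0) := by
      have h2 : Tendsto (fun n => 2 * C * r n) atTop (𝓝 0) := by simpa using hr0.const_mul (2 * C)
      simpa using h2.sqrt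
    simpa using ((hr0.mul_const c).mul_const |U|).add (h1.const_mul c)

/-- The integral of an entropy density does not decrease from the initial time to the time `T`. -/
theorem integral_entropy_le (hu : IsWeakSolution u u₀) (hT : 0 < T)
    (hβ : IsEntropyDensity T K β βs βw) :
    Integrable (fun x => β 0 (deriv (slice u 0) x)) ∧
    Integrable (fun x => β T (deriv (slice u T) x)) ∧
    ∫ x, β 0 (deriv (slice u 0) x) ≤ ∫ x, β T (deriv (slice u T) x) := by
  obtain ⟨C, hC⟩ := hu.exists_energy_bound
  obtain ⟨c, hc0, hc⟩ := exists_isMollifier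
  obtain ⟨χ, D, hχ, hχc, hχ0, hχ1, hD, hχlim, hDlim⟩ := hu.exists_cutoff (T := T) hC
  have h0T : (0 : ℝ) ∈ Icc 0 T := ⟨le_rfl, hT.le⟩
  have hTT : T ∈ Icc 0 T := ⟨hT.le, le_rfl⟩
  have hi : ∀ s ∈ Icc 0 T, Integrable (fun x => β s (deriv (slice u s) x)) := fun s hs => by
    refine (hC s).1.mono' ((hβ.continuous_right hs).measurable.comp
      (measurable_deriv _)).aestronglyMeasurable (.of_forall fun x => ?_)
    rw [Real.norm_eq_abs, abs_of_nonneg (hβ.nonneg s hs _)]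
    exact hβ.le_sq s hs _
  refine ⟨hi 0 h0T, hi T hTT, ?_⟩
  have hd : Integrable (fun x => β T (deriv (slice u T) x) - β 0 (deriv (slice u 0) x)) :=
    (hi T hTT).sub (hi 0 h0T)
  rw [← sub_nonneg, ← integral_sub (hi T hTT) (hi 0 h0T)]
  have hlim : Tendsto (fun n => ∫ x, χ n x * (β T (deriv (slice u T) x)
      - β 0 (deriv (slice u 0) x))) atTop
      (𝓝 (∫ x, (β T (deriv (slice u T) x) - β 0 (deriv (slice u 0) x)))) := by
    refine tendsto_integral_of_dominated_convergence
      (fun x => |β T (deriv (slice u T) x) - β 0 (deriv (slice u 0) x)|) (fun n => ?_) hd.abs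
      (fun n => .of_forall fun x => ?_) (.of_forall fun x => ?_)
    · exact (hχ n).continuous.aestronglyMeasurable.mul hd.aestronglyMeasurable
    · rw [Real.norm_eq_abs, abs_mul, abs_of_nonneg (hχ0 n x)]
      exact mul_le_of_le_one_left (abs_nonneg _) (hχ1 n x)
    · simpa using (hχlim x).mul_const (β T (deriv (slice u T) x) - β 0 (deriv (slice u 0) x))
  have hlow : Tendsto (fun n => -(D n * (8 * c ^ 2 * C) * T)) atTop (𝓝 0) := by
    simpa using ((hDlim.mul_const (8 * c ^ 2 * C)).mul_const T).neg
  exact le_of_tendsto_of_tendsto' hlow hlim fun n =>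
    hu.integral_cutoff_entropy_ge hT hC hc0.le hc hβ (hχ n) (hχc n) (hχ0 n) (hχ1 n) (hD n)

end IsWeakSolution

end HunterSaxton

/-! ### Conclusion -/

theorem proposition2p2 (u : ℝ → ℝ → ℝ) (u₀ : ℝ → ℝ)
    (hu : HunterSaxton.IsWeakSolution u u₀) (t : ℝ) (ht : 0 < t) :
    Integrable (fun y => (HunterSaxton.spatialDeriv u y t) ^ 2) volume ∧
      ∫ ζ in HunterSaxton.survivalSet u₀ t, (deriv u₀ ζ) ^ 2 ≤
        ∫ y, (HunterSaxton.spatialDeriv u y t) ^ 2 := by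
  open HunterSaxton Filter Topology in
  obtain ⟨C, hC⟩ := hu.exists_energy_bound
  have hut : ∀ x, deriv (slice u t) x = spatialDeriv u x t := deriv_slice_of_nonneg u ht.le
  have hit := (hC t).1
  have hi0 := (hC 0).1
  simp only [hut] at hit
  rw [hu.slice_zero] at hi0
  refine ⟨hit, ?_⟩
  have hsurv : ∫ ζ in survivalSet u₀ t, (deriv u₀ ζ) ^ 2
      = ∫ x, if -2 / t < deriv u₀ x then deriv u₀ x ^ 2 else 0 := by
    have hm : MeasurableSet (survivalSet u₀ t) :=
      (measurableSet_of_differentiableAt ℝ u₀).inter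
        (measurableSet_lt measurable_const (measurable_deriv u₀))
    rw [← integral_indicator hm]
    congr 1
    ext x
    by_cases hx : DifferentiableAt ℝ u₀ x
    · simp [indicator, survivalSet, hx]
    -- Where `u₀` is not differentiable, `deriv` takes the value `0`, which exceeds `-2/t` but
    -- contributes `0² = 0`.
    · simp [indicator, survivalSet, hx, deriv_zero_of_not_differentiableAt hx]
  rw [hsurv]
  set e : ℕ → ℝ := fun n => 1 / ((n : ℝ) + 1)
  have he : ∀ n, 0 < e n := fun n => by positivity
  have he1 : ∀ n, e n ≤ 1 := fun n => by
    rw [div_le_one (by positivity)]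
    linarith [(Nat.cast_nonneg n : (0 : ℝ) ≤ n)]
  have he0 : Tendsto e atTop (𝓝 0) := tendsto_one_div_add_atTop_nhds_zero_nat
  have hstep : ∀ n, ∫ x, (posDensity (e n) (deriv u₀ x) + negDensity (e n) t (deriv u₀ x))
      ≤ ∫ y, (spatialDeriv u y t) ^ 2 := by
    intro n
    obtain ⟨p0, p1, p⟩ := hu.integral_entropy_le ht
      (isEntropyDensity_posDensity (T := t) (he n) (he1 n))
    obtain ⟨q0, q1, q⟩ := hu.integral_entropy_le ht
      (isEntropyDensity_negDensity (he n) (he1 n) ht.le)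
    simp only [hu.slice_zero, hut, sub_zero, sub_self] at p0 p1 p q0 q1 q
    rw [integral_add p0 q0]
    refine (add_le_add p q).trans ?_
    rw [← integral_add p1 q1]
    exact integral_mono (p1.add q1) hit fun x =>
      -- At the final time the remaining lifetime `σ` is `0`.
      (posDensity_add_negDensity_mem_Icc (he n) (he1 n) le_rfl).2
  refine le_of_tendsto' (tendsto_integral_of_dominated_convergence (fun x => deriv u₀ x ^ 2)
    (fun n => ?_) hi0 (fun n => .of_forall fun x => ?_)
    (.of_forall fun x => tendsto_posDensity_add_negDensity he0 ht (deriv u₀ x))) hstep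
  · have := measurable_deriv u₀
    refine Measurable.aestronglyMeasurable ?_
    unfold posDensity negDensity
    fun_prop
  · obtain ⟨h1, h2⟩ := posDensity_add_negDensity_mem_Icc (w := deriv u₀ x) (he n) (he1 n) ht.le
    rwa [Real.norm_eq_abs, abs_of_nonneg h1]
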